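/- All manifolds are smooth, connected and Hausdorff, and $n\ge 0$. A locally conformal symplectic (l.c.s.) structure of the first kind on a manifold $M$ of dimension $2n+2$ is a pair $(\omega,\eta)$ of $1$-forms (the Lee and the anti-Lee $1$-form) such that $\omega$ is closed, $d\eta$ has rank $2n$, and $\omega\wedge\eta\wedge(d\eta)^n$ is a volume form. Its Lee vector field $U$ and anti-Lee vector field $V$ are the vector fields characterized by $$\omega(U)=1,\quad \eta(U)=0,\quad i_U d\eta=0,\qquad\qquad \omega(V)=0,\quad \eta(V)=1,\quad i_V d\eta=0 .$$ A contact form on a manifold $N$ of dimension $2n+1$ is a $1$-form $\eta_N$ such that $\eta_N\wedge(d\eta_N)^n$ is a volume form; its Reeb vector field $\xi$ is characterized by $\eta_N(\xi)=1$ and $i_\xi d\eta_N=0$. **Proposition 5.1.** Let $M$ be a compact $(2n+2)$-dimensional manifold with an l.c.s. structure of the first kind $(\omega,\eta)$, with Lee vector field $U$ and anti-Lee vector field $V$. Suppose that the space $N$ of orbits of $U$ is a quotient manifold of $M$, that is, $N$ is a manifold of dimension $2n+1$ and the canonical projection $\pi\colon M\to N$, whose fibres are the orbits of $U$, is a surjective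 submersion. Then: (i) There exists a contact $1$-form $\eta_N$ on $N$ such that $\pi^*\eta_N=\eta$. Moreover, $V$ is $\pi$-projectable, and its projection $\xi$, a vector field on $N$ with $d\pi(V(x))=\xi(\pi(x))$ for all $x\in M$, is the Reeb vector field of $(N,\eta_N)$. (ii) There exists a Riemannian metric $g$ on $M$ such that $U$ is unitary and parallel (with respect to the Levi-Civita connection of $g$), and $\omega(X)=g(X,U)$ for all vector fields $X$ on $M$. -/

import Mathlib

open scoped Manifold ContDiff
open Bundle

noncomputable section

namespace LCS

section Algebra

variable {W : Type*} [AddCommGroup W] [Module ℝ W]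

/-- The wedge product of two alternating forms (the sum over all shuffles). -/
def wedge {k l : ℕ} (a : W [⋀^Fin k]→ₗ[ℝ] ℝ) (b : W [⋀^Fin l]→ₗ[ℝ] ℝ) :
    W [⋀^Fin (k + l)]→ₗ[ℝ] ℝ :=
  ((LinearMap.mul' ℝ ℝ).compAlternatingMap (a.domCoprod b)).domDomCongr finSumFinEquiv

/-- The `n`-fold wedge power of a `2`-form. -/
def wedgePow (b : W [⋀^Fin 2]→ₗ[ℝ] ℝ) : (n : ℕ) → W [⋀^Fin (2 * n)]→ₗ[ℝ] ℝ
  | 0 => (AlternatingMap.constOfIsEmpty ℝ W (Fin 0) 1 : W [⋀^Fin 0]→ₗ[ℝ] ℝ)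
  | n + 1 => wedge (wedgePow b n) b

/-- A linear functional, seen as an alternating `1`-form. -/
def toForm (f : W →ₗ[ℝ] ℝ) : W [⋀^Fin 1]→ₗ[ℝ] ℝ :=
  AlternatingMap.ofSubsingleton ℝ W ℝ (0 : Fin 1) f

/-- The rank of a `2`-form `b`, i.e. the rank of the linear map `v ↦ b(v, ·)`. -/
def formRank (b : W [⋀^Fin 2]→ₗ[ℝ] ℝ) : ℕ :=
  Module.finrank ℝ (LinearMap.range b.curryLeft)

end Algebra

section Manifold

variable {E : Type*} [NormedAddCommGroup E] [NormedSpace ℝ E]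
  {M : Type*} [TopologicalSpace M] [ChartedSpace E M]
  {E' : Type*} [NormedAddCommGroup E'] [NormedSpace ℝ E']
  {N : Type*} [TopologicalSpace N] [ChartedSpace E' N]

/-- Smoothness of a vector field, as a section of the tangent bundle. -/
def IsSmoothField [IsManifold 𝓘(ℝ, E) ∞ M] (X : Π x : M, TangentSpace 𝓘(ℝ, E) x) : Prop :=
  ContMDiff 𝓘(ℝ, E) (𝓘(ℝ, E).prod 𝓘(ℝ, E)) ∞
    (fun x ↦ (TotalSpace.mk' E x (X x) : TangentBundle 𝓘(ℝ, E) M))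

/-- Smoothness of a `1`-form, as a section of the cotangent bundle. -/
def IsSmoothOneForm [IsManifold 𝓘(ℝ, E) ∞ M]
    (α : Π x : M, TangentSpace 𝓘(ℝ, E) x →L[ℝ] ℝ) : Prop :=
  ContMDiff 𝓘(ℝ, E) (𝓘(ℝ, E).prod 𝓘(ℝ, E →L[ℝ] ℝ)) ∞
    (fun x ↦ TotalSpace.mk' (E →L[ℝ] ℝ)
      (E := fun x : M ↦ TangentSpace 𝓘(ℝ, E) x →L[ℝ] ℝ) x (α x))

/-- The expression of a `1`-form in the chart at `x₀`: its pullback, under the inverse of that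
chart, to the model space. -/
def chartForm (α : Π x : M, TangentSpace 𝓘(ℝ, E) x →L[ℝ] ℝ) (x₀ : M) : E → E →L[ℝ] ℝ :=
  fun y ↦ (α ((extChartAt 𝓘(ℝ, E) x₀).symm y)).comp
    (mfderiv 𝓘(ℝ, E) 𝓘(ℝ, E) (extChartAt 𝓘(ℝ, E) x₀).symm y)

/-- The exterior derivative `dα` of a `1`-form `α` on a manifold: the value at `x` is computed in
the chart at `x`, with the exterior derivative of the model space, and pulled back to `x`. The
convention is `dα(X, Y) = X(α(Y)) - Y(α(X)) - α([X, Y])`. -/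
def extDer (α : Π x : M, TangentSpace 𝓘(ℝ, E) x →L[ℝ] ℝ) (x : M) :
    TangentSpace 𝓘(ℝ, E) x [⋀^Fin 2]→ₗ[ℝ] ℝ :=
  ((extDeriv (fun y : E ↦
      ContinuousAlternatingMap.ofSubsingleton ℝ E ℝ (0 : Fin 1) (chartForm α x y))
      (extChartAt 𝓘(ℝ, E) x x)).toAlternatingMap).compLinearMap
    (mfderiv 𝓘(ℝ, E) 𝓘(ℝ, E) (extChartAt 𝓘(ℝ, E) x) x).toLinearMap

/-- `(θ, η)`, with Lee form `θ` and anti-Lee form `η`, is a locally conformal symplectic structure of the first kind on `M`, where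
`dim M = 2n + 2`: `θ` is closed, `dη` has rank `2n`, and `θ ∧ η ∧ (dη)ⁿ` is a volume form. -/
structure IsLCSFirstKind [IsManifold 𝓘(ℝ, E) ∞ M] (n : ℕ)
    (θ η : Π x : M, TangentSpace 𝓘(ℝ, E) x →L[ℝ] ℝ) : Prop where
  dim : Module.finrank ℝ E = 2 * n + 2
  smooth_lee : IsSmoothOneForm θ
  smooth_antiLee : IsSmoothOneForm η
  closed : ∀ x, extDer θ x = 0
  rank : ∀ x, formRank (extDer η x) = 2 * n
  volume : ∀ x, wedge (wedge (toForm (θ x).toLinearMap) (toForm (η x).toLinearMap))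
    (wedgePow (extDer η x) n) ≠ 0

/-- The Lee vector field `U`: `θ(U) = 1`, `η(U) = 0`, `i_U dη = 0`. -/
structure IsLeeField [IsManifold 𝓘(ℝ, E) ∞ M]
    (θ η : Π x : M, TangentSpace 𝓘(ℝ, E) x →L[ℝ] ℝ)
    (U : Π x : M, TangentSpace 𝓘(ℝ, E) x) : Prop where
  smooth : IsSmoothField U
  lee : ∀ x, θ x (U x) = 1
  antiLee : ∀ x, η x (U x) = 0
  interior : ∀ x, (extDer η x).curryLeft (U x) = 0

/-- The anti-Lee vector field `V`: `θ(V) = 0`, `η(V) = 1`, `i_V dη = 0`. -/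
structure IsAntiLeeField [IsManifold 𝓘(ℝ, E) ∞ M]
    (θ η : Π x : M, TangentSpace 𝓘(ℝ, E) x →L[ℝ] ℝ)
    (V : Π x : M, TangentSpace 𝓘(ℝ, E) x) : Prop where
  smooth : IsSmoothField V
  lee : ∀ x, θ x (V x) = 0
  antiLee : ∀ x, η x (V x) = 1
  interior : ∀ x, (extDer η x).curryLeft (V x) = 0

/-- `η` is a contact form on a manifold of dimension `2n + 1`: `η ∧ (dη)ⁿ` is a volume form. -/
structure IsContactForm [IsManifold 𝓘(ℝ, E) ∞ M] (n : ℕ)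
    (η : Π x : M, TangentSpace 𝓘(ℝ, E) x →L[ℝ] ℝ) : Prop where
  dim : Module.finrank ℝ E = 2 * n + 1
  smooth : IsSmoothOneForm η
  volume : ∀ x, wedge (toForm (η x).toLinearMap) (wedgePow (extDer η x) n) ≠ 0

/-- The Reeb vector field `ξ` of a contact form `η`: `i_ξ η = 1`, `i_ξ dη = 0`. -/
structure IsReebField [IsManifold 𝓘(ℝ, E) ∞ M]
    (η : Π x : M, TangentSpace 𝓘(ℝ, E) x →L[ℝ] ℝ)
    (ξ : Π x : M, TangentSpace 𝓘(ℝ, E) x) : Prop where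
  smooth : IsSmoothField ξ
  apply : ∀ x, η x (ξ x) = 1
  interior : ∀ x, (extDer η x).curryLeft (ξ x) = 0

/-- The orbit of `x` under the flow of a (complete) vector field. -/
def orbit (U : Π x : M, TangentSpace 𝓘(ℝ, E) x) (x : M) : Set M :=
  {y | ∃ (γ : ℝ → M) (t : ℝ), IsMIntegralCurve (I := 𝓘(ℝ, E)) γ U ∧ γ 0 = x ∧ γ t = y}

/-- The manifold `N`, with canonical projection `p`, is the space of orbits of `U` as a quotient
manifold of `M`: the points of `N` are the orbits of `U` (`p` is onto and its fibres are exactly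
the orbits), and the smooth structure of `N` makes `p` a submersion. -/
structure IsOrbitManifold (U : Π x : M, TangentSpace 𝓘(ℝ, E) x) (p : M → N) : Prop where
  surjective : Function.Surjective p
  fibre : ∀ x, p ⁻¹' {p x} = orbit U x
  submersion : Manifold.IsSubmersion 𝓘(ℝ, E) 𝓘(ℝ, E') ∞ p

/-- The pullback `p^* α` of a `1`-form. -/
def pullback (p : M → N) (α : Π y : N, TangentSpace 𝓘(ℝ, E') y →L[ℝ] ℝ) :
    Π x : M, TangentSpace 𝓘(ℝ, E) x →L[ℝ] ℝ :=
  fun x ↦ (α (p x)).comp (mfderiv 𝓘(ℝ, E) 𝓘(ℝ, E') p x)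

/-- The vector field `V` on `M` projects under `p` to the vector field `ξ` on `N`. -/
def ProjectsTo (p : M → N) (V : Π x : M, TangentSpace 𝓘(ℝ, E) x)
    (ξ : Π y : N, TangentSpace 𝓘(ℝ, E') y) : Prop :=
  ∀ x, mfderiv 𝓘(ℝ, E) 𝓘(ℝ, E') p x (V x) = ξ (p x)

/-- `nabla` is the Levi-Civita connection of the Riemannian metric `g`: it is torsion-free and
`X(g(Y, Z)) = g(∇_X Y, Z) + g(Y, ∇_X Z)`. In Mathlib, `nabla Y x v` stands for `(∇_v Y)(x)`. -/
structure IsLeviCivita [IsManifold 𝓘(ℝ, E) ∞ M] [FiniteDimensional ℝ E] [CompleteSpace E]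
    (g : ContMDiffRiemannianMetric 𝓘(ℝ, E) ∞ E (fun x : M ↦ TangentSpace 𝓘(ℝ, E) x))
    (nabla : CovariantDerivative 𝓘(ℝ, E) E (fun x : M ↦ TangentSpace 𝓘(ℝ, E) x)) : Prop where
  torsion : nabla.torsion = 0
  metric : ∀ (Y Z : Π x : M, TangentSpace 𝓘(ℝ, E) x) (x : M),
    MDifferentiableAt 𝓘(ℝ, E) (𝓘(ℝ, E).prod 𝓘(ℝ, E))
      (fun y ↦ (TotalSpace.mk' E y (Y y) : TangentBundle 𝓘(ℝ, E) M)) x →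
    MDifferentiableAt 𝓘(ℝ, E) (𝓘(ℝ, E).prod 𝓘(ℝ, E))
      (fun y ↦ (TotalSpace.mk' E y (Z y) : TangentBundle 𝓘(ℝ, E) M)) x →
    ∀ v : TangentSpace 𝓘(ℝ, E) x,
      mvfderiv 𝓘(ℝ, E) (fun y ↦ g.inner y (Y y) (Z y)) x v =
        g.inner x (nabla Y x v) (Z x) + g.inner x (Y x) (nabla Z x v)

/-- The vector field `U` is parallel with respect to the Riemannian metric `g`: `∇U = 0`, with `∇`
the Levi-Civita connection of `g`. -/
def IsParallel [IsManifold 𝓘(ℝ, E) ∞ M] [FiniteDimensional ℝ E] [CompleteSpace E]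
    (g : ContMDiffRiemannianMetric 𝓘(ℝ, E) ∞ E (fun x : M ↦ TangentSpace 𝓘(ℝ, E) x))
    (U : Π x : M, TangentSpace 𝓘(ℝ, E) x) : Prop :=
  ∃ nabla : CovariantDerivative 𝓘(ℝ, E) E (fun x : M ↦ TangentSpace 𝓘(ℝ, E) x),
    IsLeviCivita g nabla ∧ ∀ x, nabla U x = 0

end Manifold

end LCS

end

/-! Part (i). From `η(U) = 0` and `i_U dη = 0` one gets `L_U η = 0`, so `η` is basic for `p`.
Pointwise, `ker dp` is the line spanned by `U`, hence `η_x = β_x ∘ dp_x` for a functional `β_x`. In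
a fixed chart, `η` and `dp` satisfy the same linear equation `A' = -A ∘ DU` along an integral curve
of `U`, so `β` has zero derivative there (`hasDerivAt_zero_of_comp`, `eq_of_isMIntegralCurve`).
Since a fibre is one orbit, `β` descends to a form `ηN`; it is smooth because locally `ηN = s^*η`
for a section `s` of `p`.

Naturality gives `dη = p^*(dηN)` (`extDer_pullback`). If `ηN ∧ (dηN)ⁿ` vanished at `p x`, then `η ∧
(dη)ⁿ` would vanish at `x`, and by associativity so would `θ ∧ η ∧ (dη)ⁿ` (`wedge_wedge_eq_zero`).
The vector `dp(V)` satisfies the Reeb equations at each point. The rank condition makes `ker dη`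
two-dimensional, spanned by `U` and `V`, so these equations have a unique solution
(`eq_apply_of_formRank`) and `dp(V)` depends only on the point of `N`.

Part (ii). Take a Riemannian metric `h` on `N` and put `g = p^*h + θ ⊗ θ`. As `dp(U) = 0` and `θ(U)
= 1`, the form `θ` is `g(·, U)` and `U` is a unit field. Closedness of `θ` gives `L_U θ = 0`, so `U`
is Killing (`killing_of_pullback_add`). Thus `g(∇_v U, w)` is antisymmetric in `v, w` because `U` is
Killing, and symmetric because `θ` is closed, so it is zero (`fderiv_add_christoffel_eq_zero`). The
Levi-Civita connection is built from Christoffel symbols, each computed in the chart centred at the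
point. -/

open scoped Manifold ContDiff TensorProduct Topology
open Bundle

noncomputable section

namespace LCS

/-! ### Naturality and associativity of the wedge product. -/

section Algebra

variable {W : Type*} [AddCommGroup W] [Module ℝ W]
  {W' : Type*} [AddCommGroup W'] [Module ℝ W']

/-- Wedge products are natural under linear maps. -/
lemma wedge_compLinearMap {k l : ℕ} (a : W' [⋀^Fin k]→ₗ[ℝ] ℝ) (b : W' [⋀^Fin l]→ₗ[ℝ] ℝ)
    (f : W →ₗ[ℝ] W') :
    wedge (a.compLinearMap f) (b.compLinearMap f) = (wedge a b).compLinearMap f := by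
  ext v
  simp only [wedge, AlternatingMap.domDomCongr_apply, LinearMap.compAlternatingMap_apply,
    AlternatingMap.compLinearMap_apply, AlternatingMap.domCoprod_apply, sum_apply, map_sum]
  refine Finset.sum_congr rfl fun σ _ ↦ ?_
  induction σ using Quotient.inductionOn' with
  | h σ =>
    simp only [AlternatingMap.domCoprod.summand_mk'', smul_apply,
      MultilinearMap.domDomCongr_apply, MultilinearMap.domCoprod_apply]
    rfl

lemma wedgePow_compLinearMap (b : W' [⋀^Fin 2]→ₗ[ℝ] ℝ) (f : W →ₗ[ℝ] W') (n : ℕ) :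
    wedgePow (b.compLinearMap f) n = (wedgePow b n).compLinearMap f := by
  induction n with
  | zero => ext v; simp [wedgePow]
  | succ n ih => rw [wedgePow, wedgePow, ih, wedge_compLinearMap]

lemma toForm_comp (a : W' →ₗ[ℝ] ℝ) (f : W →ₗ[ℝ] W') :
    toForm (a ∘ₗ f) = (toForm a).compLinearMap f := by
  ext v; simp [toForm]

/-- The product of two multilinear forms. -/
def mulForm {k l : ℕ} (a : MultilinearMap ℝ (fun _ : Fin k ↦ W) ℝ)
    (b : MultilinearMap ℝ (fun _ : Fin l ↦ W) ℝ) :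
    MultilinearMap ℝ (fun _ : Fin (k + l) ↦ W) ℝ :=
  ((LinearMap.mul' ℝ ℝ).compMultilinearMap (a.domCoprod b)).domDomCongr finSumFinEquiv

lemma mulForm_apply {k l : ℕ} (a : MultilinearMap ℝ (fun _ : Fin k ↦ W) ℝ)
    (b : MultilinearMap ℝ (fun _ : Fin l ↦ W) ℝ) (v : Fin (k + l) → W) :
    mulForm a b v = a (fun i ↦ v (Fin.castAdd l i)) * b (fun i ↦ v (Fin.natAdd k i)) := by
  simp [mulForm]

lemma alternatization_domDomCongr {ι ι' R M N : Type*} [Fintype ι] [DecidableEq ι] [Fintype ι']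
    [DecidableEq ι'] [CommRing R] [AddCommGroup M] [Module R M] [AddCommGroup N] [Module R N]
    (e : ι ≃ ι') (a : MultilinearMap R (fun _ : ι ↦ M) N) :
    MultilinearMap.alternatization (a.domDomCongr e) =
      (MultilinearMap.alternatization a).domDomCongr e := by
  ext v
  simp only [MultilinearMap.alternatization_apply, AlternatingMap.domDomCongr_apply]
  refine Fintype.sum_equiv e.symm.permCongr _ _ fun σ ↦ ?_
  rw [Equiv.Perm.sign_permCongr]
  simp [MultilinearMap.domDomCongr_apply, Equiv.permCongr_apply]

/-- Alternatization is the unnormalised sum over all permutations, so no factorials appear. This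
reduces associativity of the wedge to that of the product of multilinear forms. -/
lemma wedge_alternatization {k l : ℕ} (a : MultilinearMap ℝ (fun _ : Fin k ↦ W) ℝ)
    (b : MultilinearMap ℝ (fun _ : Fin l ↦ W) ℝ) :
    wedge (MultilinearMap.alternatization a) (MultilinearMap.alternatization b) =
      MultilinearMap.alternatization (mulForm a b) := by
  rw [wedge, ← MultilinearMap.domCoprod_alternization, mulForm, alternatization_domDomCongr,
    LinearMap.compMultilinearMap_alternatization]

lemma mulForm_assoc {k l m : ℕ} (a : MultilinearMap ℝ (fun _ : Fin k ↦ W) ℝ)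
    (b : MultilinearMap ℝ (fun _ : Fin l ↦ W) ℝ) (c : MultilinearMap ℝ (fun _ : Fin m ↦ W) ℝ) :
    mulForm (mulForm a b) c =
      (mulForm a (mulForm b c)).domDomCongr (finCongr (Nat.add_assoc k l m).symm) := by
  ext v
  simp only [mulForm_apply, MultilinearMap.domDomCongr_apply, mul_assoc]
  congr 3
  ext i
  congr 1
  ext
  simp [Nat.add_assoc]

/-- Associativity of the wedge product, in the form `(a ∧ b) ∧ c = 0` as soon as `b ∧ c = 0`. -/
lemma wedge_wedge_eq_zero {k l m : ℕ} {a : W [⋀^Fin k]→ₗ[ℝ] ℝ} {b : W [⋀^Fin l]→ₗ[ℝ] ℝ}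
    {c : W [⋀^Fin m]→ₗ[ℝ] ℝ} (h : wedge b c = 0) : wedge (wedge a b) c = 0 := by
  -- Alternatizing an alternating `j`-form multiplies it by `j!`, whence the factor.
  have alt {j : ℕ} (a : W [⋀^Fin j]→ₗ[ℝ] ℝ) :
      a = MultilinearMap.alternatization ((j.factorial : ℝ)⁻¹ • (a : MultilinearMap ℝ _ ℝ)) := by
    rw [← AlternatingMap.coe_smul, AlternatingMap.coe_alternatization, Fintype.card_fin,
      ← Nat.cast_smul_eq_nsmul ℝ, smul_smul, mul_inv_cancel₀ (by positivity), one_smul]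
  rw [alt b, alt c, wedge_alternatization] at h
  rw [alt a, alt b, alt c, wedge_alternatization, wedge_alternatization, mulForm_assoc,
    alternatization_domDomCongr, ← wedge_alternatization, h]
  ext v
  simp [wedge, ← AlternatingMap.domCoprod'_apply]
end Algebra

/-! ### Pointwise identities in a normed space. -/

section Calculus

set_option synthInstance.maxHeartbeats 200000
set_option maxSynthPendingDepth 3

variable {E : Type*} [NormedAddCommGroup E] [NormedSpace ℝ E]
  {E' : Type*} [NormedAddCommGroup E'] [NormedSpace ℝ E']

/-- The Christoffel symbols of a metric with value `g` and derivative `D` at a point. -/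
lemma exists_christoffel [FiniteDimensional ℝ E] (g : E →L[ℝ] E →L[ℝ] ℝ)
    (hg : ∀ v, v ≠ 0 → 0 < g v v) (D : E →L[ℝ] E →L[ℝ] E →L[ℝ] ℝ) :
    ∃ Γ : E →L[ℝ] E →L[ℝ] E,
      ∀ v w z, g (Γ v w) z = (D v w z + D w v z - D z v w) / 2 := by
  have hinj : Function.Injective g := by
    rw [injective_iff_map_eq_zero]
    intro v hv
    by_contra h
    simpa [hv] using hg v h
  have hfin : Module.finrank ℝ E = Module.finrank ℝ (E →L[ℝ] ℝ) := by
    rw [← LinearMap.toContinuousLinearMap.finrank_eq (R := ℝ) (M := E →ₗ[ℝ] ℝ)]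
    exact (Subspace.dual_finrank_eq (K := ℝ) (V := E)).symm
  let e : E ≃ₗ[ℝ] (E →L[ℝ] ℝ) := LinearEquiv.ofInjectiveOfFinrankEq g.toLinearMap hinj hfin
  let e' : (E →L[ℝ] ℝ) →L[ℝ] E := (e.symm : (E →L[ℝ] ℝ) →ₗ[ℝ] E).toContinuousLinearMap
  have he (a : E →L[ℝ] ℝ) : g (e' a) = a := e.apply_symm_apply a
  -- `T v w z = D z v w`, the subtracted term of the Koszul formula.
  let T : E →L[ℝ] E →L[ℝ] E →L[ℝ] ℝ :=
    ((ContinuousLinearMap.flipₗᵢ ℝ E E ℝ).toContinuousLinearEquiv : _ →L[ℝ] _) ∘L D.flip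
  refine ⟨(ContinuousLinearMap.compL ℝ E (E →L[ℝ] ℝ) E e') ∘L
    ((2⁻¹ : ℝ) • (D + D.flip - T)), fun v w z ↦ ?_⟩
  simp [he, T]
  ring

/-- The identity `L_u α = 0`, for a `1`-form `α` with `i_u dα = 0` and `α(u)` constant. -/
lemma fderiv_form_add_eq_zero {α : E → E →L[ℝ] ℝ} {u : E → E} {q : E} {c : ℝ}
    (hα : DifferentiableAt ℝ α q) (hu : DifferentiableAt ℝ u q)
    (hc : ∀ᶠ y in 𝓝 q, α y (u y) = c)
    (hd : ∀ v, fderiv ℝ α q (u q) v = fderiv ℝ α q v (u q)) (v : E) :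
    fderiv ℝ α q (u q) v + α q (fderiv ℝ u q v) = 0 := by
  have h1 := hα.hasFDerivAt.clm_apply hu.hasFDerivAt
  have h2 : HasFDerivAt (fun y ↦ α y (u y)) (0 : E →L[ℝ] ℝ) q :=
    (hasFDerivAt_const c q).congr_of_eventuallyEq hc
  have := congr($(h1.unique h2) v)
  simp at this
  rw [hd]
  linarith

/-- If `dP(u) = 0` near `q`, then `d²P(u, v) + dP(du(v)) = 0` at `q`. -/
lemma fderiv_fderiv_add_eq_zero {P : E → E'} {u : E → E} {q : E} (hP : ContDiffAt ℝ ∞ P q)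
    (hu : DifferentiableAt ℝ u q) (h0 : ∀ᶠ y in 𝓝 q, fderiv ℝ P y (u y) = 0) (v : E) :
    fderiv ℝ (fderiv ℝ P) q (u q) v + fderiv ℝ P q (fderiv ℝ u q v) = 0 := by
  have hd : DifferentiableAt ℝ (fderiv ℝ P) q :=
    (hP.fderiv_right (m := ∞) (by simp)).differentiableAt (by simp)
  have h1 := hd.hasFDerivAt.clm_apply hu.hasFDerivAt
  have h2 : HasFDerivAt (fun y ↦ fderiv ℝ P y (u y)) (0 : E →L[ℝ] E') q :=
    (hasFDerivAt_const 0 q).congr_of_eventuallyEq h0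
  have := congr($(h1.unique h2) v)
  simp at this
  have hs : IsSymmSndFDerivAt ℝ P q := hP.isSymmSndFDerivAt (by simpa using ENat.LEInfty.out)
  rw [hs.eq, ← this, add_comm]

/-- `u` is a Killing field of `P^*h + α ⊗ α` when `dP(u) = 0` and `L_u α = 0`. -/
lemma killing_of_pullback_add {P : E → E'} {u : E → E} {q : E} {h : E' → E' →L[ℝ] E' →L[ℝ] ℝ}
    {α : E → E →L[ℝ] ℝ} {G : E → E →L[ℝ] E →L[ℝ] ℝ} (hP : ContDiffAt ℝ ∞ P q)
    (hu : DifferentiableAt ℝ u q) (hh : DifferentiableAt ℝ h (P q)) (hα : DifferentiableAt ℝ α q)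
    (hGd : DifferentiableAt ℝ G q) (h0 : ∀ᶠ y in 𝓝 q, fderiv ℝ P y (u y) = 0)
    (hL : ∀ v, fderiv ℝ α q (u q) v + α q (fderiv ℝ u q v) = 0)
    (hG : ∀ᶠ y in 𝓝 q, ∀ v w,
      G y v w = h (P y) (fderiv ℝ P y v) (fderiv ℝ P y w) + α y v * α y w) (v w : E) :
    fderiv ℝ G q (u q) v w + G q (fderiv ℝ u q v) w + G q v (fderiv ℝ u q w) = 0 := by
  have hd : DifferentiableAt ℝ (fderiv ℝ P) q :=
    (hP.fderiv_right (m := ∞) (by simp)).differentiableAt (by simp)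
  have hP1 : HasFDerivAt P (fderiv ℝ P q) q := (hP.differentiableAt (by simp)).hasFDerivAt
  have e (v : E) : HasFDerivAt (fun y ↦ fderiv ℝ P y v) _ q :=
    hd.hasFDerivAt.clm_apply (hasFDerivAt_const v q)
  have a (v : E) : HasFDerivAt (fun y ↦ α y v) _ q :=
    hα.hasFDerivAt.clm_apply (hasFDerivAt_const v q)
  have h1 := ((((hh.hasFDerivAt.comp q hP1).clm_apply (e v)).clm_apply (e w)).add
    ((a v).mul (a w)))
  have h2 : HasFDerivAt (fun y ↦ G y v w) _ q :=
    (hGd.hasFDerivAt.clm_apply (hasFDerivAt_const v q)).clm_apply (hasFDerivAt_const w q)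
  have h3 := h2.unique (h1.congr_of_eventuallyEq (hG.mono fun y hy ↦ hy v w))
  have h4 := congr($h3 (u q))
  have hu0 : fderiv ℝ P q (u q) = 0 := h0.self_of_nhds
  have k (v : E) := eq_neg_of_add_eq_zero_left (fderiv_fderiv_add_eq_zero hP hu h0 v)
  have l (v : E) := eq_neg_of_add_eq_zero_left (hL v)
  -- The derivative of `h` is taken along `dP(u) = 0` and drops out; `k` and `l` rewrite the
  -- derivatives of `dP` and `α` along `u` as terms in `du`.
  simp [hu0, k, l] at h4
  rw [h4, hG.self_of_nhds, hG.self_of_nhds]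
  ring

/-- A Killing field whose dual `1`-form is closed is parallel. -/
lemma fderiv_add_christoffel_eq_zero {u : E → E} {q : E} {α : E → E →L[ℝ] ℝ}
    {G : E → E →L[ℝ] E →L[ℝ] ℝ} {Γ : E →L[ℝ] E →L[ℝ] E}
    (hpos : ∀ v, v ≠ 0 → 0 < G q v v) (hsymm : ∀ y v w, G y v w = G y w v)
    (hu : DifferentiableAt ℝ u q) (hα : DifferentiableAt ℝ α q) (hG : DifferentiableAt ℝ G q)
    (hΓ : ∀ v w z, G q (Γ v w) z =
      (fderiv ℝ G q v w z + fderiv ℝ G q w v z - fderiv ℝ G q z v w) / 2)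
    (hαG : ∀ᶠ y in 𝓝 q, ∀ v, α y v = G y v (u y))
    (hclosed : ∀ v w, fderiv ℝ α q v w = fderiv ℝ α q w v)
    (hK : ∀ v w, fderiv ℝ G q (u q) v w + G q (fderiv ℝ u q v) w + G q v (fderiv ℝ u q w) = 0)
    (v : E) : fderiv ℝ u q v + Γ v (u q) = 0 := by
  have hDα (v w : E) : fderiv ℝ α q v w = fderiv ℝ G q v w (u q) + G q w (fderiv ℝ u q v) := by
    have h1 : HasFDerivAt (fun y ↦ α y w) _ q :=
      hα.hasFDerivAt.clm_apply (hasFDerivAt_const w q)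
    have h2 : HasFDerivAt (fun y ↦ G y w (u y)) _ q :=
      (hG.hasFDerivAt.clm_apply (hasFDerivAt_const w q)).clm_apply hu.hasFDerivAt
    have := congr($(h1.unique (h2.congr_of_eventuallyEq (hαG.mono fun y hy ↦ hy w))) v)
    simp at this
    rw [this, add_comm]
  have hDsymm (a v w : E) : fderiv ℝ G q a v w = fderiv ℝ G q a w v := by
    have h2 (v w : E) : HasFDerivAt (fun y ↦ G y v w) _ q :=
      (hG.hasFDerivAt.clm_apply (hasFDerivAt_const v q)).clm_apply (hasFDerivAt_const w q)
    have := congr($((h2 v w).unique ((h2 w v).congr_of_eventuallyEq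
      (.of_forall fun y ↦ hsymm y v w))) a)
    simpa using this
  -- The coordinate form of "symmetric and antisymmetric, hence zero": `hclosed` and `hK` evaluate
  -- the two parts of the Koszul expression, which then equals `-G(du(v), z)`.
  have key (z : E) : G q (fderiv ℝ u q v + Γ v (u q)) z = 0 := by
    have h1 := hclosed v z
    rw [hDα, hDα] at h1
    rw [map_add, add_apply, hΓ]
    have h2 := hK v z
    rw [hDsymm v (u q) z]
    rw [hsymm q z] at h1
    linarith
  by_contra hne
  exact (hpos _ hne).ne' (key _)

/-- The factor `b` in `A = b ∘ B` is stationary where `A' = -A ∘ L` and `B' = -B ∘ L`. -/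
lemma hasDerivAt_zero_of_comp [FiniteDimensional ℝ E] [FiniteDimensional ℝ E']
    {A : ℝ → E →L[ℝ] ℝ} {B : ℝ → E →L[ℝ] E'} {b : ℝ → E' →L[ℝ] ℝ} {L : E →L[ℝ] E} {t : ℝ}
    (hb : ∀ᶠ s in 𝓝 t, A s = b s ∘L B s) (hA : HasDerivAt A (-(A t ∘L L)) t)
    (hB : HasDerivAt B (-(B t ∘L L)) t) (hsurj : Function.Surjective (B t)) :
    HasDerivAt b 0 t := by
  -- With `R` a fixed right inverse of `B t`, the map `C s = B s ∘ R` is the identity at `t`, hence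
  -- invertible nearby. Then `b = A ∘ R ∘ C⁻¹`, which makes `b` differentiable without assuming it.
  obtain ⟨R, hR⟩ := (B t).exists_rightInverse_of_surjective (LinearMap.range_eq_top.2 hsurj)
  let C : ℝ → E' →L[ℝ] E' := fun s ↦ B s ∘L R
  have hC : HasDerivAt C (-(B t ∘L L) ∘L R) t := by
    simpa [C] using hB.clm_comp (hasDerivAt_const t R)
  have hCt : C t = 1 := hR
  have hinv : HasDerivAt (fun s ↦ Ring.inverse (C s)) (-(-(B t ∘L L) ∘L R)) t := by
    have h1 := hasFDerivAt_ringInverse (𝕜 := ℝ) (R := E' →L[ℝ] E') 1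
    rw [Units.val_one, ← hCt] at h1
    refine HasDerivAt.congr_deriv (h1.comp_hasDerivAt t hC) ?_
    ext z
    simp
  have hev : ∀ᶠ s in 𝓝 t, b s = (A s ∘L R) ∘L Ring.inverse (C s) := by
    have hunit : ∀ᶠ s in 𝓝 t, IsUnit (C s) :=
      hC.continuousAt.eventually_mem (Units.isOpen.mem_nhds (by simp [hCt]))
    filter_upwards [hb, hunit] with s hs hu
    have : C s * Ring.inverse (C s) = 1 := Ring.mul_inverse_cancel _ hu
    rw [hs]
    ext v
    have := congr($this v)
    simp only [ContinuousLinearMap.mul_def, ContinuousLinearMap.comp_apply, C] at this ⊢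
    rw [this]
    rfl
  have hD := ((hA.clm_comp (hasDerivAt_const t R)).clm_comp hinv).congr_of_eventuallyEq hev
  refine hD.congr_deriv ?_
  ext v
  have hRv (z : E') : B t (R z) = z := congr($hR z)
  rw [hCt, hb.self_of_nhds]
  simp [hRv]

end Calculus

/-! ### Tensor fields read in the chart centred at a point. -/

section Charts

set_option maxSynthPendingDepth 3

variable {E : Type*} [NormedAddCommGroup E] [NormedSpace ℝ E]
  {M : Type*} [TopologicalSpace M] [ChartedSpace E M]

/-- The derivative of the inverse of the chart at `x₀`. -/
def chartFrame (x₀ : M) (y : E) : E →L[ℝ] E :=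
  mfderiv 𝓘(ℝ, E) 𝓘(ℝ, E) (extChartAt 𝓘(ℝ, E) x₀).symm y

/-- The expression of a field of bilinear forms in the chart at `x₀`. -/
def chartBilin (g : Π x : M, TangentSpace 𝓘(ℝ, E) x →L[ℝ] TangentSpace 𝓘(ℝ, E) x →L[ℝ] ℝ)
    (x₀ : M) : E → E →L[ℝ] E →L[ℝ] ℝ :=
  fun y ↦ ContinuousLinearMap.bilinearComp (E := E) (F := E)
    (g ((extChartAt 𝓘(ℝ, E) x₀).symm y)) (chartFrame x₀ y) (chartFrame x₀ y)

/-- The expression of a vector field in the chart at `x₀`. -/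
def chartField (X : Π x : M, TangentSpace 𝓘(ℝ, E) x) (x₀ : M) : E → E :=
  fun y ↦ (chartFrame x₀ y).inverse (X ((extChartAt 𝓘(ℝ, E) x₀).symm y))

lemma chartForm_apply (α : Π x : M, TangentSpace 𝓘(ℝ, E) x →L[ℝ] ℝ) (x₀ : M) (y v : E) :
    chartForm α x₀ y v = α ((extChartAt 𝓘(ℝ, E) x₀).symm y) (chartFrame x₀ y v) := rfl

lemma chartBilin_apply
    (g : Π x : M, TangentSpace 𝓘(ℝ, E) x →L[ℝ] TangentSpace 𝓘(ℝ, E) x →L[ℝ] ℝ)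
    (x₀ : M) (y v w : E) :
    chartBilin g x₀ y v w =
      g ((extChartAt 𝓘(ℝ, E) x₀).symm y) (chartFrame x₀ y v) (chartFrame x₀ y w) := rfl

lemma contMDiffAt_iff_contDiffAt_chart {F : Type*} [NormedAddCommGroup F] [NormedSpace ℝ F]
    {f : M → F} {x₀ : M} {k : ℕ∞ω} :
    ContMDiffAt 𝓘(ℝ, E) 𝓘(ℝ, F) k f x₀ ↔
      ContDiffAt ℝ k (fun y ↦ f ((extChartAt 𝓘(ℝ, E) x₀).symm y)) (extChartAt 𝓘(ℝ, E) x₀ x₀) := by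
  rw [contMDiffAt_iff, extChartAt_model_space_eq_id, ModelWithCorners.range_eq_univ,
    contDiffWithinAt_univ]
  refine ⟨fun h ↦ h.2, fun h ↦ ⟨?_, h⟩⟩
  have h1 : ContinuousAt
      ((fun y ↦ f ((extChartAt 𝓘(ℝ, E) x₀).symm y)) ∘ extChartAt 𝓘(ℝ, E) x₀) x₀ :=
    ContinuousAt.comp h.continuousAt (continuousAt_extChartAt x₀)
  refine h1.congr ?_
  filter_upwards [extChartAt_source_mem_nhds (I := 𝓘(ℝ, E)) x₀] with y hy
  simp only [Function.comp_apply, (extChartAt 𝓘(ℝ, E) x₀).left_inv hy]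

lemma eventually_mem_chart_target (x₀ : M) :
    ∀ᶠ y in 𝓝 (extChartAt 𝓘(ℝ, E) x₀ x₀), y ∈ (extChartAt 𝓘(ℝ, E) x₀).target :=
  extChartAt_target_mem_nhds x₀

lemma contDiffAt_iff_of_eventuallyEq {F F' : Type*} [NormedAddCommGroup F] [NormedSpace ℝ F]
    [NormedAddCommGroup F'] [NormedSpace ℝ F'] {f g : F → F'} {x : F} {k : ℕ∞ω}
    (h : f =ᶠ[𝓝 x] g) : ContDiffAt ℝ k f x ↔ ContDiffAt ℝ k g x :=
  ⟨fun hf ↦ hf.congr_of_eventuallyEq h.symm, fun hg ↦ hg.congr_of_eventuallyEq h⟩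

variable [IsManifold 𝓘(ℝ, E) ∞ M]

/-- The tangent space at `x₀` is identified with `E` by the preferred chart at `x₀`. Values at the
centre of a chart therefore need no change of basis. -/
lemma chartFrame_center (x₀ : M) :
    chartFrame x₀ (extChartAt 𝓘(ℝ, E) x₀ x₀) = ContinuousLinearMap.id ℝ E := by
  have := mfderivWithin_range_extChartAt_symm (I := 𝓘(ℝ, E)) (x := x₀)
  rw [ModelWithCorners.range_eq_univ, mfderivWithin_univ] at this
  exact this

lemma chartFrame_isInvertible {x₀ : M} {y : E} (hy : y ∈ (extChartAt 𝓘(ℝ, E) x₀).target) :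
    (chartFrame x₀ y).IsInvertible := by
  have := isInvertible_mfderivWithin_extChartAt_symm (I := 𝓘(ℝ, E)) hy
  rw [ModelWithCorners.range_eq_univ, mfderivWithin_univ] at this
  exact this

lemma chartFrame_chartField (X : Π x : M, TangentSpace 𝓘(ℝ, E) x) {x₀ : M} {y : E}
    (hy : y ∈ (extChartAt 𝓘(ℝ, E) x₀).target) :
    chartFrame x₀ y (chartField X x₀ y) = X ((extChartAt 𝓘(ℝ, E) x₀).symm y) :=
  (chartFrame_isInvertible hy).self_apply_inverse _

lemma chartField_center (X : Π x : M, TangentSpace 𝓘(ℝ, E) x) (x₀ : M) :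
    chartField X x₀ (extChartAt 𝓘(ℝ, E) x₀ x₀) = X x₀ := by
  rw [chartField, chartFrame_center, extChartAt_to_inv, ContinuousLinearMap.inverse_id]
  rfl

lemma chartBilin_center
    (g : Π x : M, TangentSpace 𝓘(ℝ, E) x →L[ℝ] TangentSpace 𝓘(ℝ, E) x →L[ℝ] ℝ) (x₀ : M) :
    chartBilin g x₀ (extChartAt 𝓘(ℝ, E) x₀ x₀) = g x₀ := by
  ext v w
  rw [chartBilin_apply, chartFrame_center, extChartAt_to_inv]
  rfl

lemma differentiableAt_chartField [CompleteSpace E] {X : Π x : M, TangentSpace 𝓘(ℝ, E) x} {x₀ : M}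
    (hX : MDifferentiableAt 𝓘(ℝ, E) (𝓘(ℝ, E).prod 𝓘(ℝ, E))
      (fun y ↦ (TotalSpace.mk' E y (X y) : TangentBundle 𝓘(ℝ, E) M)) x₀) :
    DifferentiableAt ℝ (chartField X x₀) (extChartAt 𝓘(ℝ, E) x₀ x₀) := by
  rw [← mdifferentiableWithinAt_univ] at hX
  have := hX.differentiableWithinAt_mpullbackWithin_vectorField
  rw [ModelWithCorners.range_eq_univ, Set.preimage_univ, Set.univ_inter] at this
  replace this := differentiableWithinAt_univ.1 this
  refine this.congr_of_eventuallyEq (.of_forall fun y ↦ ?_)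
  rw [VectorField.mpullbackWithin_apply, mfderivWithin_univ]
  rfl

lemma symmL_eq_chartFrame {x₀ : M} {y : E} (hy : y ∈ (extChartAt 𝓘(ℝ, E) x₀).target) (v : E) :
    (trivializationAt E (TangentSpace 𝓘(ℝ, E)) x₀).symmL ℝ ((extChartAt 𝓘(ℝ, E) x₀).symm y) v =
      chartFrame x₀ y v := by
  have hy' : (extChartAt 𝓘(ℝ, E) x₀).symm y ∈ (chartAt E x₀).source := by
    simpa using (extChartAt 𝓘(ℝ, E) x₀).map_target hy
  rw [TangentBundle.symmL_trivializationAt (I := 𝓘(ℝ, E)) hy', ModelWithCorners.range_eq_univ,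
    mfderivWithin_univ, (extChartAt 𝓘(ℝ, E) x₀).right_inv hy]
  rfl

/-- Smoothness of a `1`-form, as a section of the cotangent bundle, at a point. -/
def IsSmoothFormAt (α : Π x : M, TangentSpace 𝓘(ℝ, E) x →L[ℝ] ℝ) (x₀ : M) : Prop :=
  ContMDiffAt 𝓘(ℝ, E) (𝓘(ℝ, E).prod 𝓘(ℝ, E →L[ℝ] ℝ)) ∞
    (fun x ↦ TotalSpace.mk' (E →L[ℝ] ℝ)
      (E := fun x : M ↦ TangentSpace 𝓘(ℝ, E) x →L[ℝ] ℝ) x (α x)) x₀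

/-- Over the chart domain, the inverse of the tangent bundle trivialization is the derivative of the
inverse chart, so the section in coordinates is `chartForm`. -/
lemma isSmoothFormAt_iff {α : Π x : M, TangentSpace 𝓘(ℝ, E) x →L[ℝ] ℝ} {x₀ : M} :
    IsSmoothFormAt α x₀ ↔ ContDiffAt ℝ ∞ (chartForm α x₀) (extChartAt 𝓘(ℝ, E) x₀ x₀) := by
  rw [IsSmoothFormAt, contMDiffAt_section, contMDiffAt_iff_contDiffAt_chart]
  refine contDiffAt_iff_of_eventuallyEq ?_
  filter_upwards [eventually_mem_chart_target x₀] with y hy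
  have hy' : (extChartAt 𝓘(ℝ, E) x₀).symm y ∈ (chartAt E x₀).source := by
    simpa using (extChartAt 𝓘(ℝ, E) x₀).map_target hy
  ext v
  rw [hom_trivializationAt_apply, ContinuousLinearMap.inCoordinates]
  change (trivializationAt ℝ (Bundle.Trivial M ℝ) x₀).continuousLinearMapAt ℝ
    ((extChartAt 𝓘(ℝ, E) x₀).symm y) (α _ ((trivializationAt E (TangentSpace 𝓘(ℝ, E)) x₀).symmL ℝ
      ((extChartAt 𝓘(ℝ, E) x₀).symm y) v)) = _
  rw [symmL_eq_chartFrame hy]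
  exact DFunLike.congr_fun (Bundle.Trivial.continuousLinearMapAt_trivialization ℝ M ℝ _) _

/-- Smoothness of a field of bilinear forms at a point. -/
def IsSmoothBilinAt
    (g : Π x : M, TangentSpace 𝓘(ℝ, E) x →L[ℝ] TangentSpace 𝓘(ℝ, E) x →L[ℝ] ℝ) (x₀ : M) : Prop :=
  ContMDiffAt 𝓘(ℝ, E) (𝓘(ℝ, E).prod 𝓘(ℝ, E →L[ℝ] E →L[ℝ] ℝ)) ∞
    (fun x ↦ TotalSpace.mk' (E →L[ℝ] E →L[ℝ] ℝ)
      (E := fun x : M ↦ TangentSpace 𝓘(ℝ, E) x →L[ℝ] TangentSpace 𝓘(ℝ, E) x →L[ℝ] ℝ) x (g x)) x₀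

lemma isSmoothBilinAt_iff
    {g : Π x : M, TangentSpace 𝓘(ℝ, E) x →L[ℝ] TangentSpace 𝓘(ℝ, E) x →L[ℝ] ℝ} {x₀ : M} :
    IsSmoothBilinAt g x₀ ↔ ContDiffAt ℝ ∞ (chartBilin g x₀) (extChartAt 𝓘(ℝ, E) x₀ x₀) := by
  rw [IsSmoothBilinAt, contMDiffAt_section, contMDiffAt_iff_contDiffAt_chart]
  refine contDiffAt_iff_of_eventuallyEq ?_
  filter_upwards [eventually_mem_chart_target x₀] with y hy
  have hy' : (extChartAt 𝓘(ℝ, E) x₀).symm y ∈ (chartAt E x₀).source := by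
    simpa using (extChartAt 𝓘(ℝ, E) x₀).map_target hy
  ext v w
  rw [hom_trivializationAt_apply]
  refine (inCoordinates_apply_eq₂ (E₃ := Bundle.Trivial M ℝ) (x₀ := x₀)
    (x := (extChartAt 𝓘(ℝ, E) x₀).symm y) (v := v) (w := w) hy' hy'
    (Set.mem_univ _)).trans ?_
  have h (v : E) : (trivializationAt E (TangentSpace 𝓘(ℝ, E)) x₀).symm
      ((extChartAt 𝓘(ℝ, E) x₀).symm y) v = chartFrame x₀ y v := by
    rw [← symmL_eq_chartFrame hy, Trivialization.symmL_apply]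
    exact hy'
  rw [h, h]
  exact DFunLike.congr_fun (Bundle.Trivial.linearMapAt_trivialization ℝ M ℝ _) _

end Charts

/-! ### Pullbacks, and naturality of the exterior derivative. -/

section Pullback

set_option maxSynthPendingDepth 3

variable {E : Type*} [NormedAddCommGroup E] [NormedSpace ℝ E]
  {M : Type*} [TopologicalSpace M] [ChartedSpace E M] [IsManifold 𝓘(ℝ, E) ∞ M]
  {E' : Type*} [NormedAddCommGroup E'] [NormedSpace ℝ E']
  {N : Type*} [TopologicalSpace N] [ChartedSpace E' N] [IsManifold 𝓘(ℝ, E') ∞ N]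

/-- The exterior derivative at `x` is computed in the chart at `x`. -/
lemma extDer_eq (α : Π x : M, TangentSpace 𝓘(ℝ, E) x →L[ℝ] ℝ) (x : M) :
    extDer α x = (extDeriv (fun y : E ↦ ContinuousAlternatingMap.ofSubsingleton ℝ E ℝ (0 : Fin 1)
      (chartForm α x y)) (extChartAt 𝓘(ℝ, E) x x)).toAlternatingMap := by
  rw [extDer, mfderiv_extChartAt_self]
  rfl

omit [IsManifold 𝓘(ℝ, E) ∞ M] in
lemma differentiableAt_ofSubsingleton {α : E → E →L[ℝ] ℝ} {q : E} (hα : DifferentiableAt ℝ α q) :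
    DifferentiableAt ℝ
      (fun y ↦ ContinuousAlternatingMap.ofSubsingleton ℝ E ℝ (0 : Fin 1) (α y)) q :=
  (ContinuousAlternatingMap.ofSubsingletonLIE (𝕜 := ℝ) (E := E) (F := ℝ)
    (0 : Fin 1)).differentiableAt.comp _ hα

omit [IsManifold 𝓘(ℝ, E) ∞ M] in
lemma extDeriv_ofSubsingleton_apply {α : E → E →L[ℝ] ℝ} {q : E} (hα : DifferentiableAt ℝ α q)
    (v w : E) :
    extDeriv (fun y ↦ ContinuousAlternatingMap.ofSubsingleton ℝ E ℝ (0 : Fin 1) (α y)) q ![v, w] =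
      fderiv ℝ α q v w - fderiv ℝ α q w v := by
  have he (w : E) : fderiv ℝ (fun y ↦ α y w) q = (fderiv ℝ α q).flip w := by
    have := (hα.hasFDerivAt.clm_apply (hasFDerivAt_const w _)).fderiv
    simpa using this
  rw [extDeriv_apply (differentiableAt_ofSubsingleton hα) ![v, w]]
  simp [Fin.sum_univ_two, Fin.removeNth_apply, he, sub_eq_add_neg]

lemma extDer_apply {α : Π x : M, TangentSpace 𝓘(ℝ, E) x →L[ℝ] ℝ} {x : M}
    (hα : DifferentiableAt ℝ (chartForm α x) (extChartAt 𝓘(ℝ, E) x x)) (v w : E) :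
    extDer α x ![v, w] = fderiv ℝ (chartForm α x) (extChartAt 𝓘(ℝ, E) x x) v w -
      fderiv ℝ (chartForm α x) (extChartAt 𝓘(ℝ, E) x x) w v :=
  (DFunLike.congr_fun (extDer_eq α x) ![v, w]).trans (extDeriv_ofSubsingleton_apply hα v w)

lemma fderiv_chartForm_swap_of_curryLeft {α : Π x : M, TangentSpace 𝓘(ℝ, E) x →L[ℝ] ℝ} {x : M}
    (hα : DifferentiableAt ℝ (chartForm α x) (extChartAt 𝓘(ℝ, E) x x))
    {u : TangentSpace 𝓘(ℝ, E) x} (hu : (extDer α x).curryLeft u = 0) (v : E) :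
    fderiv ℝ (chartForm α x) (extChartAt 𝓘(ℝ, E) x x) u v =
      fderiv ℝ (chartForm α x) (extChartAt 𝓘(ℝ, E) x x) v u := by
  have h1 : extDer α x ![u, v] = 0 := congr($hu ![v])
  exact sub_eq_zero.1 ((extDer_apply hα u v).symm.trans h1)

variable (E E') in
/-- The expression of a map in the charts at `x₀` and `f x₀`. -/
abbrev chartMap (f : M → N) (x₀ : M) : E → E' := writtenInExtChartAt 𝓘(ℝ, E) 𝓘(ℝ, E') x₀ f

omit [IsManifold 𝓘(ℝ, E) ∞ M] [IsManifold 𝓘(ℝ, E') ∞ N] in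
lemma contDiffAt_chartMap {f : M → N} {x₀ : M} (hf : ContMDiffAt 𝓘(ℝ, E) 𝓘(ℝ, E') ∞ f x₀) :
    ContDiffAt ℝ ∞ (chartMap E E' f x₀) (extChartAt 𝓘(ℝ, E) x₀ x₀) := by
  have := (contMDiffAt_iff.1 hf).2
  rwa [ModelWithCorners.range_eq_univ, contDiffWithinAt_univ] at this

omit [IsManifold 𝓘(ℝ, E) ∞ M] [IsManifold 𝓘(ℝ, E') ∞ N] in
lemma fderiv_chartMap_center {f : M → N} {x₀ : M}
    (hf : ContMDiffAt 𝓘(ℝ, E) 𝓘(ℝ, E') ∞ f x₀) :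
    fderiv ℝ (chartMap E E' f x₀) (extChartAt 𝓘(ℝ, E) x₀ x₀) =
      mfderiv 𝓘(ℝ, E) 𝓘(ℝ, E') f x₀ := by
  rw [(hf.mdifferentiableAt (by simp)).mfderiv, ModelWithCorners.range_eq_univ, fderivWithin_univ]

omit [IsManifold 𝓘(ℝ, E) ∞ M] [IsManifold 𝓘(ℝ, E') ∞ N] in
lemma chartMap_center (f : M → N) (x₀ : M) :
    chartMap E E' f x₀ (extChartAt 𝓘(ℝ, E) x₀ x₀) = extChartAt 𝓘(ℝ, E') (f x₀) (f x₀) := by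
  simp [chartMap, writtenInExtChartAt]

omit [IsManifold 𝓘(ℝ, E) ∞ M] in
lemma tendsto_extChartAt_symm (x₀ : M) :
    Filter.Tendsto (extChartAt 𝓘(ℝ, E) x₀).symm (𝓝 (extChartAt 𝓘(ℝ, E) x₀ x₀)) (𝓝 x₀) := by
  have := continuousAt_extChartAt_symm (I := 𝓘(ℝ, E)) x₀
  rwa [ContinuousAt, extChartAt_to_inv] at this

/-- The derivative of a map, read in charts. -/
lemma eventually_chartMap {f : M → N} {x₀ : M} (hf : ContMDiffAt 𝓘(ℝ, E) 𝓘(ℝ, E') ∞ f x₀) :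
    ∀ᶠ y in 𝓝 (extChartAt 𝓘(ℝ, E) x₀ x₀),
      (extChartAt 𝓘(ℝ, E') (f x₀)).symm (chartMap E E' f x₀ y) = f ((extChartAt 𝓘(ℝ, E) x₀).symm y) ∧
      ∀ v, chartFrame (f x₀) (chartMap E E' f x₀ y) (fderiv ℝ (chartMap E E' f x₀) y v) =
        mfderiv 𝓘(ℝ, E) 𝓘(ℝ, E') f ((extChartAt 𝓘(ℝ, E) x₀).symm y) (chartFrame x₀ y v) := by
  -- Being `C^∞` at a point provides a neighbourhood only for each finite order; order `1` is enough
  -- here.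
  have h1 : ∀ᶠ x in 𝓝 x₀, ContMDiffAt 𝓘(ℝ, E) 𝓘(ℝ, E') 1 f x :=
    (contMDiffAt_iff_contMDiffAt_nhds (by simp)).1 (hf.of_le (by simp))
  have h2 : ∀ᶠ x in 𝓝 x₀, f x ∈ (extChartAt 𝓘(ℝ, E') (f x₀)).source :=
    hf.continuousAt.eventually_mem (extChartAt_source_mem_nhds (f x₀))
  filter_upwards [eventually_mem_chart_target x₀,
    (tendsto_extChartAt_symm x₀).eventually (h1.and h2)] with y hy hxy
  obtain ⟨hfy, hsrc⟩ := hxy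
  have hinv : (extChartAt 𝓘(ℝ, E') (f x₀)).symm (chartMap E E' f x₀ y) =
      f ((extChartAt 𝓘(ℝ, E) x₀).symm y) := (extChartAt 𝓘(ℝ, E') (f x₀)).left_inv hsrc
  refine ⟨hinv, fun v ↦ ?_⟩
  have hφ : MDifferentiableAt 𝓘(ℝ, E) 𝓘(ℝ, E) (extChartAt 𝓘(ℝ, E) x₀).symm y := by
    have := mdifferentiableWithinAt_extChartAt_symm (I := 𝓘(ℝ, E)) hy
    rwa [ModelWithCorners.range_eq_univ, mdifferentiableWithinAt_univ] at this
  have hψ : MDifferentiableAt 𝓘(ℝ, E') 𝓘(ℝ, E') (extChartAt 𝓘(ℝ, E') (f x₀))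
      (f ((extChartAt 𝓘(ℝ, E) x₀).symm y)) := mdifferentiableAt_extChartAt (by simpa using hsrc)
  have hfd := hfy.mdifferentiableAt one_ne_zero
  obtain ⟨L, hL, hLv⟩ : ∃ L : E →L[ℝ] E', HasFDerivAt (chartMap E E' f x₀) L y ∧
      ∀ v, L v = mfderiv 𝓘(ℝ, E') 𝓘(ℝ, E') (extChartAt 𝓘(ℝ, E') (f x₀))
        (f ((extChartAt 𝓘(ℝ, E) x₀).symm y))
        (mfderiv 𝓘(ℝ, E) 𝓘(ℝ, E') f ((extChartAt 𝓘(ℝ, E) x₀).symm y) (chartFrame x₀ y v)) :=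
    ⟨_, hasMFDerivAt_iff_hasFDerivAt.1
      (hψ.hasMFDerivAt.comp y (hfd.hasMFDerivAt.comp y hφ.hasMFDerivAt)), fun v ↦ rfl⟩
  rw [hL.fderiv, hLv]
  have hy' : chartMap E E' f x₀ y ∈ (extChartAt 𝓘(ℝ, E') (f x₀)).target :=
    (extChartAt 𝓘(ℝ, E') (f x₀)).map_source hsrc
  have hid := mfderivWithin_extChartAt_symm_comp_mfderiv_extChartAt' (I := 𝓘(ℝ, E')) hsrc
  rw [ModelWithCorners.range_eq_univ, mfderivWithin_univ] at hid
  exact congr($hid _)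

/-- The pullback of a field of bilinear forms along a map. -/
def pullbackBilin (f : M → N)
    (h : Π y : N, TangentSpace 𝓘(ℝ, E') y →L[ℝ] TangentSpace 𝓘(ℝ, E') y →L[ℝ] ℝ) :
    Π x : M, TangentSpace 𝓘(ℝ, E) x →L[ℝ] TangentSpace 𝓘(ℝ, E) x →L[ℝ] ℝ :=
  fun x ↦ ContinuousLinearMap.bilinearComp (E := E') (F := E') (E' := E) (F' := E) (h (f x))
    (mfderiv 𝓘(ℝ, E) 𝓘(ℝ, E') f x) (mfderiv 𝓘(ℝ, E) 𝓘(ℝ, E') f x)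

omit [IsManifold 𝓘(ℝ, E') ∞ N] in
lemma form_congr (α : Π y : N, TangentSpace 𝓘(ℝ, E') y →L[ℝ] ℝ) {y y' : N} (h : y = y')
    {v v' : E'} (hv : v = v') : α y v = α y' v' := by
  subst h hv; rfl

omit [IsManifold 𝓘(ℝ, E') ∞ N] in
lemma bilin_congr (α : Π y : N, TangentSpace 𝓘(ℝ, E') y →L[ℝ] TangentSpace 𝓘(ℝ, E') y →L[ℝ] ℝ)
    {y y' : N} (h : y = y') {v v' w w' : E'} (hv : v = v') (hw : w = w') :
    α y v w = α y' v' w' := by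
  subst h hv hw; rfl

lemma chartForm_pullback {f : M → N} {x₀ : M} (hf : ContMDiffAt 𝓘(ℝ, E) 𝓘(ℝ, E') ∞ f x₀)
    (α : Π y : N, TangentSpace 𝓘(ℝ, E') y →L[ℝ] ℝ) :
    chartForm (pullback f α) x₀ =ᶠ[𝓝 (extChartAt 𝓘(ℝ, E) x₀ x₀)] fun y ↦
      (chartForm α (f x₀) (chartMap E E' f x₀ y)).comp (fderiv ℝ (chartMap E E' f x₀) y) := by
  filter_upwards [eventually_chartMap hf] with y ⟨h1, h2⟩
  ext v
  exact (form_congr α h1 (h2 v)).symm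

lemma chartBilin_pullbackBilin {f : M → N} {x₀ : M} (hf : ContMDiffAt 𝓘(ℝ, E) 𝓘(ℝ, E') ∞ f x₀)
    (h : Π y : N, TangentSpace 𝓘(ℝ, E') y →L[ℝ] TangentSpace 𝓘(ℝ, E') y →L[ℝ] ℝ) :
    chartBilin (pullbackBilin f h) x₀ =ᶠ[𝓝 (extChartAt 𝓘(ℝ, E) x₀ x₀)] fun y ↦
      (chartBilin h (f x₀) (chartMap E E' f x₀ y)).bilinearComp
        (fderiv ℝ (chartMap E E' f x₀) y) (fderiv ℝ (chartMap E E' f x₀) y) := by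
  filter_upwards [eventually_chartMap hf] with y ⟨h1, h2⟩
  ext v w
  exact (bilin_congr h h1 (h2 v) (h2 w)).symm

omit [IsManifold 𝓘(ℝ, E) ∞ M] [IsManifold 𝓘(ℝ, E') ∞ N] in
lemma contDiffAt_fderiv_chartMap {f : M → N} {x₀ : M}
    (hf : ContMDiffAt 𝓘(ℝ, E) 𝓘(ℝ, E') ∞ f x₀) :
    ContDiffAt ℝ ∞ (fderiv ℝ (chartMap E E' f x₀)) (extChartAt 𝓘(ℝ, E) x₀ x₀) :=
  (contDiffAt_chartMap hf).fderiv_right (by simp)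

lemma IsSmoothFormAt.pullback {f : M → N} {x₀ : M} (hf : ContMDiffAt 𝓘(ℝ, E) 𝓘(ℝ, E') ∞ f x₀)
    {α : Π y : N, TangentSpace 𝓘(ℝ, E') y →L[ℝ] ℝ} (hα : IsSmoothFormAt α (f x₀)) :
    IsSmoothFormAt (LCS.pullback (E := E) f α) x₀ := by
  rw [isSmoothFormAt_iff] at hα ⊢
  rw [contDiffAt_iff_of_eventuallyEq (chartForm_pullback hf α)]
  rw [← chartMap_center (E := E) (E' := E') f x₀] at hα
  exact (hα.comp _ (contDiffAt_chartMap hf)).clm_comp (contDiffAt_fderiv_chartMap hf)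

lemma IsSmoothBilinAt.pullbackBilin {f : M → N} {x₀ : M}
    (hf : ContMDiffAt 𝓘(ℝ, E) 𝓘(ℝ, E') ∞ f x₀)
    {h : Π y : N, TangentSpace 𝓘(ℝ, E') y →L[ℝ] TangentSpace 𝓘(ℝ, E') y →L[ℝ] ℝ}
    (hh : IsSmoothBilinAt h (f x₀)) : IsSmoothBilinAt (LCS.pullbackBilin (E := E) f h) x₀ := by
  rw [isSmoothBilinAt_iff] at hh ⊢
  rw [contDiffAt_iff_of_eventuallyEq (chartBilin_pullbackBilin hf h)]
  rw [← chartMap_center (E := E) (E' := E') f x₀] at hh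
  have hP := contDiffAt_fderiv_chartMap hf
  have h1 := hh.comp _ (contDiffAt_chartMap hf)
  -- Composition acts on the last slot only, so each slot is composed in turn, with a flip after
  -- each.
  have h2 := (ContinuousLinearMap.flipₗᵢ ℝ E E' ℝ).contDiff.contDiffAt.comp _ (h1.clm_comp hP)
  exact (ContinuousLinearMap.flipₗᵢ ℝ E E ℝ).contDiff.contDiffAt.comp _ (h2.clm_comp hP)

/-- The exterior derivative commutes with pullbacks. -/
lemma extDer_pullback {f : M → N} {x₀ : M} (hf : ContMDiffAt 𝓘(ℝ, E) 𝓘(ℝ, E') ∞ f x₀)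
    {α : Π y : N, TangentSpace 𝓘(ℝ, E') y →L[ℝ] ℝ} (hα : IsSmoothFormAt α (f x₀)) :
    extDer (pullback f α) x₀ =
      (extDer α (f x₀)).compLinearMap (mfderiv 𝓘(ℝ, E) 𝓘(ℝ, E') f x₀).toLinearMap := by
  have hpd := (isSmoothFormAt_iff.1 (hα.pullback hf)).differentiableAt (by simp)
  have hαd := (isSmoothFormAt_iff.1 hα).differentiableAt (by simp)
  have hD := fderiv_chartMap_center hf
  have key (v w : E) : fderiv ℝ (chartForm (pullback f α) x₀) (extChartAt 𝓘(ℝ, E) x₀ x₀) v w =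
      fderiv ℝ (chartForm α (f x₀)) (extChartAt 𝓘(ℝ, E') (f x₀) (f x₀))
        (fderiv ℝ (chartMap E E' f x₀) (extChartAt 𝓘(ℝ, E) x₀ x₀) v)
        (fderiv ℝ (chartMap E E' f x₀) (extChartAt 𝓘(ℝ, E) x₀ x₀) w) +
      chartForm α (f x₀) (extChartAt 𝓘(ℝ, E') (f x₀) (f x₀))
        (fderiv ℝ (fderiv ℝ (chartMap E E' f x₀)) (extChartAt 𝓘(ℝ, E) x₀ x₀) v w) := by
    rw [(chartForm_pullback hf α).fderiv_eq]
    rw [← chartMap_center (E := E) (E' := E') f x₀] at hαd ⊢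
    have h1 := (hαd.hasFDerivAt.comp _
      ((contDiffAt_chartMap hf).differentiableAt (by simp)).hasFDerivAt).clm_comp
      ((contDiffAt_fderiv_chartMap hf).differentiableAt (by simp)).hasFDerivAt
    rw [show fderiv ℝ (fun y ↦ (chartForm α (f x₀) (chartMap E E' f x₀ y)).comp
      (fderiv ℝ (chartMap E E' f x₀) y)) _ = _ from h1.fderiv]
    simp [add_comm]
  -- The second-derivative term of `key` is symmetric and cancels on antisymmetrizing.
  have hsymm := (contDiffAt_chartMap hf).isSymmSndFDerivAt (by simpa using ENat.LEInfty.out)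
  ext v
  obtain ⟨a, b, rfl⟩ : ∃ a b : E, v = ![a, b] := ⟨v 0, v 1, by ext i; fin_cases i <;> rfl⟩
  have h1 := extDer_apply hpd a b
  have h2 := extDer_apply hαd
    (fderiv ℝ (chartMap E E' f x₀) (extChartAt 𝓘(ℝ, E) x₀ x₀) a)
    (fderiv ℝ (chartMap E E' f x₀) (extChartAt 𝓘(ℝ, E) x₀ x₀) b)
  rw [key, key, hsymm.eq a b] at h1
  refine h1.trans (Eq.trans ?_ (h2.symm.trans ?_))
  · ring
  · rw [hD]
    refine congrArg (extDer α (f x₀)) ?_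
    ext i; fin_cases i <;> rfl

/-- A vector field in the kernel of the derivative of a map, read in charts. -/
lemma fderiv_chartMap_chartField {f : M → N} {x₀ : M}
    (hf : ContMDiffAt 𝓘(ℝ, E) 𝓘(ℝ, E') ∞ f x₀) {X : Π x : M, TangentSpace 𝓘(ℝ, E) x}
    (hX : ∀ x, mfderiv 𝓘(ℝ, E) 𝓘(ℝ, E') f x (X x) = 0) :
    ∀ᶠ y in 𝓝 (extChartAt 𝓘(ℝ, E) x₀ x₀),
      fderiv ℝ (chartMap E E' f x₀) y (chartField X x₀ y) = 0 := by
  have h3 : ∀ᶠ y in 𝓝 (extChartAt 𝓘(ℝ, E) x₀ x₀),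
      chartMap E E' f x₀ y ∈ (extChartAt 𝓘(ℝ, E') (f x₀)).target := by
    refine (contDiffAt_chartMap hf).continuousAt.eventually_mem ?_
    rw [chartMap_center]
    exact extChartAt_target_mem_nhds _
  filter_upwards [eventually_chartMap hf, eventually_mem_chart_target x₀, h3] with y h hy hy'
  have h1 := h.2 (chartField X x₀ y)
  obtain ⟨e, he⟩ := chartFrame_isInvertible hy'
  have h2 : chartFrame (f x₀) (chartMap E E' f x₀ y)
      (fderiv ℝ (chartMap E E' f x₀) y (chartField X x₀ y)) = 0 := by
    refine h1.trans ?_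
    rw [chartFrame_chartField X hy]
    exact hX _
  rw [← he] at h2
  exact (map_eq_zero_iff e e.injective).1 h2

omit [IsManifold 𝓘(ℝ, E) ∞ M] in
lemma chartForm_congr {α β : Π x : M, TangentSpace 𝓘(ℝ, E) x →L[ℝ] ℝ} {x₀ : M}
    (h : ∀ᶠ x in 𝓝 x₀, α x = β x) :
    chartForm α x₀ =ᶠ[𝓝 (extChartAt 𝓘(ℝ, E) x₀ x₀)] chartForm β x₀ := by
  filter_upwards [(tendsto_extChartAt_symm x₀).eventually h] with y hy
  rw [chartForm, chartForm, hy]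

lemma IsSmoothFormAt.congr {α β : Π x : M, TangentSpace 𝓘(ℝ, E) x →L[ℝ] ℝ} {x₀ : M}
    (hβ : IsSmoothFormAt β x₀) (h : ∀ᶠ x in 𝓝 x₀, α x = β x) : IsSmoothFormAt α x₀ := by
  rw [isSmoothFormAt_iff] at hβ ⊢
  exact hβ.congr_of_eventuallyEq (chartForm_congr h)

end Pullback

/-! ### The Levi-Civita connection from Christoffel symbols. -/

section LeviCivita

set_option maxSynthPendingDepth 3

variable {E : Type*} [NormedAddCommGroup E] [NormedSpace ℝ E]
  {M : Type*} [TopologicalSpace M] [ChartedSpace E M]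

lemma mvfderiv_eq_fderiv_chart {F : Type*} [NormedAddCommGroup F] [NormedSpace ℝ F] {f : M → F}
    {x : M} (hf : MDifferentiableAt 𝓘(ℝ, E) 𝓘(ℝ, F) f x) (v : E) :
    mvfderiv 𝓘(ℝ, E) f x v =
      fderiv ℝ (fun y ↦ f ((extChartAt 𝓘(ℝ, E) x).symm y)) (extChartAt 𝓘(ℝ, E) x x) v := by
  have : mfderiv 𝓘(ℝ, E) 𝓘(ℝ, F) f x =
      fderiv ℝ (fun y ↦ f ((extChartAt 𝓘(ℝ, E) x).symm y)) (extChartAt 𝓘(ℝ, E) x x) := by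
    rw [hf.mfderiv, ModelWithCorners.range_eq_univ, fderivWithin_univ]
    rfl
  exact DFunLike.congr_fun this v

lemma differentiableAt_chart {F : Type*} [NormedAddCommGroup F] [NormedSpace ℝ F] {f : M → F}
    {x : M} (hf : MDifferentiableAt 𝓘(ℝ, E) 𝓘(ℝ, F) f x) :
    DifferentiableAt ℝ (fun y ↦ f ((extChartAt 𝓘(ℝ, E) x).symm y)) (extChartAt 𝓘(ℝ, E) x x) := by
  have := hf.differentiableWithinAt_writtenInExtChartAt
  rw [ModelWithCorners.range_eq_univ, differentiableWithinAt_univ] at this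
  exact this

lemma mdifferentiableAt_of_chart {F : Type*} [NormedAddCommGroup F] [NormedSpace ℝ F] {f : M → F}
    {x : M} (hf : DifferentiableAt ℝ (fun y ↦ f ((extChartAt 𝓘(ℝ, E) x).symm y))
      (extChartAt 𝓘(ℝ, E) x x)) : MDifferentiableAt 𝓘(ℝ, E) 𝓘(ℝ, F) f x := by
  have hc : ContinuousAt
      ((fun y ↦ f ((extChartAt 𝓘(ℝ, E) x).symm y)) ∘ extChartAt 𝓘(ℝ, E) x) x :=
    ContinuousAt.comp hf.continuousAt (continuousAt_extChartAt x)
  refine mdifferentiableAt_iff _ _ |>.2 ⟨hc.congr ?_, ?_⟩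
  · filter_upwards [extChartAt_source_mem_nhds (I := 𝓘(ℝ, E)) x] with y hy
    simp only [Function.comp_apply, (extChartAt 𝓘(ℝ, E) x).left_inv hy]
  · rw [ModelWithCorners.range_eq_univ, differentiableWithinAt_univ]
    exact hf

/-- The derivative of vector fields given at each point `x` by Christoffel symbols `Γ x` in the
chart at `x`. -/
def christoffelDerivative (Γ : M → E →L[ℝ] E →L[ℝ] E) (Y : Π x : M, TangentSpace 𝓘(ℝ, E) x)
    (x : M) : E →L[ℝ] E :=
  fderiv ℝ (chartField Y x) (extChartAt 𝓘(ℝ, E) x x) + (Γ x).flip (Y x)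

variable [IsManifold 𝓘(ℝ, E) ∞ M] [CompleteSpace E]

/-- Additivity and the Leibniz rule are pointwise in `x`, so no regularity of `Γ` in `x` is needed
and the symbols can be chosen point by point. -/
lemma isCovariantDerivativeOn_christoffelDerivative (Γ : M → E →L[ℝ] E →L[ℝ] E) :
    IsCovariantDerivativeOn (I := 𝓘(ℝ, E)) E (V := fun x : M ↦ TangentSpace 𝓘(ℝ, E) x)
      (christoffelDerivative Γ) where
  add {Y Z x} hY hZ _ := by
    have h : chartField (Y + Z) x = fun y ↦ chartField Y x y + chartField Z x y := by
      ext y; exact map_add (chartFrame x y).inverse _ _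
    ext v
    have h1 : fderiv ℝ (chartField (Y + Z) x) (extChartAt 𝓘(ℝ, E) x x) v =
        fderiv ℝ (chartField Y x) (extChartAt 𝓘(ℝ, E) x x) v +
          fderiv ℝ (chartField Z x) (extChartAt 𝓘(ℝ, E) x x) v := by
      rw [h, fderiv_fun_add (differentiableAt_chartField hY) (differentiableAt_chartField hZ)]
      rfl
    have h2 : Γ x v ((Y + Z) x) = Γ x v (Y x) + Γ x v (Z x) := map_add (Γ x v) (Y x) (Z x)
    exact (congrArg₂ (· + ·) h1 h2).trans (add_add_add_comm _ _ _ _)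
  leibniz {Y f x} hY hf _ := by
    have h : chartField (f • Y) x = fun y ↦ f ((extChartAt 𝓘(ℝ, E) x).symm y) • chartField Y x y := by
      ext y; exact map_smul (chartFrame x y).inverse _ _
    ext v
    have h1 (y : E) (hy : y = Y x) :
        fderiv ℝ (chartField (f • Y) x) (extChartAt 𝓘(ℝ, E) x x) v =
        f x • fderiv ℝ (chartField Y x) (extChartAt 𝓘(ℝ, E) x x) v +
          mvfderiv 𝓘(ℝ, E) f x v • y := by
      rw [h, mvfderiv_eq_fderiv_chart hf,
        fderiv_fun_smul (differentiableAt_chart hf) (differentiableAt_chartField hY),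
        chartField_center, extChartAt_to_inv, hy]
      rfl
    have h2 : Γ x v ((f • Y) x) = f x • Γ x v (Y x) := map_smul (Γ x v) (f x) (Y x)
    have alg (r s : ℝ) (a b y : E) : (r • a + s • y) + r • b = r • (a + b) + s • y := by module
    exact (congrArg₂ (· + ·) (h1 _ rfl) h2).trans (alg _ _ _ _ _)

/-- The covariant derivative with given Christoffel symbols. -/
def christoffelConnection (Γ : M → E →L[ℝ] E →L[ℝ] E) :
    CovariantDerivative 𝓘(ℝ, E) E (fun x : M ↦ TangentSpace 𝓘(ℝ, E) x) where
  toFun := christoffelDerivative Γ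
  isCovariantDerivativeOnUniv := isCovariantDerivativeOn_christoffelDerivative Γ

omit [CompleteSpace E] in
lemma mlieBracket_eq_chart (X Y : Π x : M, TangentSpace 𝓘(ℝ, E) x) (x : M) :
    VectorField.mlieBracket 𝓘(ℝ, E) X Y x =
      fderiv ℝ (chartField Y x) (extChartAt 𝓘(ℝ, E) x x) (X x) -
        fderiv ℝ (chartField X x) (extChartAt 𝓘(ℝ, E) x x) (Y x) := by
  have hpull (Z : Π x : M, TangentSpace 𝓘(ℝ, E) x) :
      VectorField.mpullbackWithin 𝓘(ℝ, E) 𝓘(ℝ, E) (extChartAt 𝓘(ℝ, E) x).symm Z Set.univ =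
        chartField Z x := by
    ext y
    rw [VectorField.mpullbackWithin_apply, mfderivWithin_univ]
    rfl
  rw [← VectorField.mlieBracketWithin_univ, VectorField.mlieBracketWithin_apply,
    mfderiv_extChartAt_self, ModelWithCorners.range_eq_univ, hpull, hpull, Set.preimage_univ,
    Set.univ_inter, VectorField.lieBracketWithin_univ]
  have h (u : E) : (ContinuousLinearMap.id ℝ E).inverse u = u := by
    rw [ContinuousLinearMap.inverse_id]
    rfl
  exact (h _).trans (congrArg₂ (· - ·) (congrArg _ (chartField_center X x))
    (congrArg _ (chartField_center Y x)))

variable [FiniteDimensional ℝ E]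

lemma torsion_christoffelConnection {Γ : M → E →L[ℝ] E →L[ℝ] E}
    (hΓ : ∀ x v w, Γ x v w = Γ x w v) : (christoffelConnection Γ).torsion = 0 := by
  rw [CovariantDerivative.torsion_eq_zero_iff]
  intro X Y x hX hY
  rw [mlieBracket_eq_chart]
  have h : (fderiv ℝ (chartField Y x) (extChartAt 𝓘(ℝ, E) x x) (X x) + Γ x (X x) (Y x)) -
      (fderiv ℝ (chartField X x) (extChartAt 𝓘(ℝ, E) x x) (Y x) + Γ x (Y x) (X x)) =
      fderiv ℝ (chartField Y x) (extChartAt 𝓘(ℝ, E) x x) (X x) -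
        fderiv ℝ (chartField X x) (extChartAt 𝓘(ℝ, E) x x) (Y x) := by
    rw [hΓ x (X x) (Y x), add_sub_add_right_eq_sub]
  exact h

omit [FiniteDimensional ℝ E] [CompleteSpace E] in
lemma chartBilin_chartField
    (g : Π x : M, TangentSpace 𝓘(ℝ, E) x →L[ℝ] TangentSpace 𝓘(ℝ, E) x →L[ℝ] ℝ)
    (Y Z : Π x : M, TangentSpace 𝓘(ℝ, E) x) (x : M) :
    (fun y ↦ g ((extChartAt 𝓘(ℝ, E) x).symm y) (Y ((extChartAt 𝓘(ℝ, E) x).symm y))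
      (Z ((extChartAt 𝓘(ℝ, E) x).symm y))) =ᶠ[𝓝 (extChartAt 𝓘(ℝ, E) x x)]
      fun y ↦ chartBilin g x y (chartField Y x y) (chartField Z x y) := by
  filter_upwards [eventually_mem_chart_target x] with y hy
  rw [chartBilin_apply, chartFrame_chartField Y hy, chartFrame_chartField Z hy]

omit [CompleteSpace E] [FiniteDimensional ℝ E] in
lemma mvfderiv_bilin
    {g : Π x : M, TangentSpace 𝓘(ℝ, E) x →L[ℝ] TangentSpace 𝓘(ℝ, E) x →L[ℝ] ℝ}
    {Y Z : Π x : M, TangentSpace 𝓘(ℝ, E) x} {x : M}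
    (hg : DifferentiableAt ℝ (chartBilin g x) (extChartAt 𝓘(ℝ, E) x x))
    (hY : DifferentiableAt ℝ (chartField Y x) (extChartAt 𝓘(ℝ, E) x x))
    (hZ : DifferentiableAt ℝ (chartField Z x) (extChartAt 𝓘(ℝ, E) x x)) (v : E) :
    mvfderiv 𝓘(ℝ, E) (fun y ↦ g y (Y y) (Z y)) x v =
      fderiv ℝ (chartBilin g x) (extChartAt 𝓘(ℝ, E) x x) v (Y x) (Z x) +
      g x (fderiv ℝ (chartField Y x) (extChartAt 𝓘(ℝ, E) x x) v) (Z x) +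
      g x (Y x) (fderiv ℝ (chartField Z x) (extChartAt 𝓘(ℝ, E) x x) v) := by
  have h := ((hg.hasFDerivAt.clm_apply hY.hasFDerivAt).clm_apply
    hZ.hasFDerivAt).congr_of_eventuallyEq (chartBilin_chartField g Y Z x)
  rw [mvfderiv_eq_fderiv_chart (mdifferentiableAt_of_chart h.differentiableAt), h.fderiv,
    chartField_center, chartField_center, ← chartBilin_center g x]
  change chartBilin g x (extChartAt 𝓘(ℝ, E) x x) (Y x)
      (fderiv ℝ (chartField Z x) (extChartAt 𝓘(ℝ, E) x x) v) +
    (chartBilin g x (extChartAt 𝓘(ℝ, E) x x)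
      (fderiv ℝ (chartField Y x) (extChartAt 𝓘(ℝ, E) x x) v) (Z x) +
    fderiv ℝ (chartBilin g x) (extChartAt 𝓘(ℝ, E) x x) v (Y x) (Z x)) = _
  have alg (a b c : ℝ) : a + (b + c) = c + b + a := by ring
  exact alg _ _ _

omit [CompleteSpace E] in
/-- The Christoffel symbols of a metric in a normed space at a point. -/
lemma exists_levi_civita_symbols {G : E → E →L[ℝ] E →L[ℝ] ℝ} {q : E}
    (hpos : ∀ v, v ≠ 0 → 0 < G q v v) (hsymm : ∀ y v w, G y v w = G y w v)
    (hG : DifferentiableAt ℝ G q) :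
    ∃ Γ : E →L[ℝ] E →L[ℝ] E,
      (∀ v w z, G q (Γ v w) z =
        (fderiv ℝ G q v w z + fderiv ℝ G q w v z - fderiv ℝ G q z v w) / 2) ∧
      (∀ v w, Γ v w = Γ w v) ∧
      ∀ v y z, fderiv ℝ G q v y z = G q (Γ v y) z + G q (Γ v z) y := by
  have hsymm' (v w z : E) : fderiv ℝ G q v w z = fderiv ℝ G q v z w := by
    have h : G = fun y ↦ (G y).flip := by
      ext y v w; exact hsymm _ _ _
    have h1 := (ContinuousLinearMap.flipₗᵢ ℝ E E ℝ).hasFDerivAt.comp _ hG.hasFDerivAt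
    have h2 : fderiv ℝ G q = _ :=
      (h1.congr_of_eventuallyEq (.of_forall fun y ↦ congr_fun h y)).fderiv
    exact congr($h2 v w z)
  obtain ⟨Γ, hΓ⟩ := exists_christoffel _ hpos (fderiv ℝ G q)
  refine ⟨Γ, hΓ, fun v w ↦ ?_, fun v y z ↦ ?_⟩
  · by_contra hne
    refine (hpos _ (sub_ne_zero.2 hne)).ne' ?_
    have h0 : G q (Γ v w) = G q (Γ w v) := by
      ext z
      rw [hΓ, hΓ, hsymm' z v w]
      ring
    rw [map_sub (G q), h0, sub_self]
    rfl
  · rw [hΓ, hΓ, hsymm' v z y, hsymm' y v z, hsymm' z v y]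
    ring

lemma isLeviCivita_christoffelConnection
    (g : ContMDiffRiemannianMetric 𝓘(ℝ, E) ∞ E (fun x : M ↦ TangentSpace 𝓘(ℝ, E) x))
    {Γ : M → E →L[ℝ] E →L[ℝ] E} (hΓsymm : ∀ x v w, Γ x v w = Γ x w v)
    (hmetric : ∀ x v y z, fderiv ℝ (chartBilin g.inner x) (extChartAt 𝓘(ℝ, E) x x) v y z =
        chartBilin g.inner x (extChartAt 𝓘(ℝ, E) x x) (Γ x v y) z +
        chartBilin g.inner x (extChartAt 𝓘(ℝ, E) x x) (Γ x v z) y) :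
    IsLeviCivita g (christoffelConnection Γ) := by
  refine ⟨torsion_christoffelConnection hΓsymm, fun Y Z x hY hZ v ↦ ?_⟩
  refine (mvfderiv_bilin ((isSmoothBilinAt_iff.1 (g.contMDiff x)).differentiableAt (by simp))
    (differentiableAt_chartField hY) (differentiableAt_chartField hZ) v).trans ?_
  have hY' : g.inner x (christoffelConnection Γ Y x v) (Z x) =
      g.inner x (fderiv ℝ (chartField Y x) (extChartAt 𝓘(ℝ, E) x x) v) (Z x) +
      chartBilin g.inner x (extChartAt 𝓘(ℝ, E) x x) (Γ x v (Y x)) (Z x) := by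
    rw [chartBilin_center]
    exact congr($(map_add (g.inner x) _ _) (Z x))
  have hZ' : g.inner x (Y x) (christoffelConnection Γ Z x v) =
      g.inner x (Y x) (fderiv ℝ (chartField Z x) (extChartAt 𝓘(ℝ, E) x x) v) +
      chartBilin g.inner x (extChartAt 𝓘(ℝ, E) x x) (Γ x v (Z x)) (Y x) := by
    rw [chartBilin_center]
    exact (map_add (g.inner x (Y x)) _ _).trans (congrArg _ (g.symm x _ _))
  have alg {a b c d e : ℝ} (h : a = d + e) : a + b + c = (b + d) + (c + e) := by rw [h]; ring
  exact (alg (hmetric x v (Y x) (Z x))).trans (congrArg₂ (· + ·) hY'.symm hZ'.symm)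

/-- Every Riemannian metric has a Levi-Civita connection, given by Christoffel symbols. -/
lemma exists_isLeviCivita
    (g : ContMDiffRiemannianMetric 𝓘(ℝ, E) ∞ E (fun x : M ↦ TangentSpace 𝓘(ℝ, E) x)) :
    ∃ Γ : M → E →L[ℝ] E →L[ℝ] E,
      (∀ x v w z, chartBilin g.inner x (extChartAt 𝓘(ℝ, E) x x) (Γ x v w) z =
        (fderiv ℝ (chartBilin g.inner x) (extChartAt 𝓘(ℝ, E) x x) v w z +
          fderiv ℝ (chartBilin g.inner x) (extChartAt 𝓘(ℝ, E) x x) w v z -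
          fderiv ℝ (chartBilin g.inner x) (extChartAt 𝓘(ℝ, E) x x) z v w) / 2) ∧
      IsLeviCivita g (christoffelConnection Γ) := by
  have h (x : M) := exists_levi_civita_symbols (G := chartBilin g.inner x)
    (q := extChartAt 𝓘(ℝ, E) x x)
    (fun v hv ↦ by rw [chartBilin_center]; exact g.pos x v hv) (fun y v w ↦ g.symm _ _ _)
    ((isSmoothBilinAt_iff.1 (g.contMDiff x)).differentiableAt (by simp))
  choose Γ hΓ hΓsymm hmetric using h
  exact ⟨Γ, hΓ, isLeviCivita_christoffelConnection g hΓsymm hmetric⟩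

/-- A vector field dual to a closed `1`-form and preserving the metric infinitesimally is
parallel. -/
lemma isParallel_of_closed_of_killing
    (g : ContMDiffRiemannianMetric 𝓘(ℝ, E) ∞ E (fun x : M ↦ TangentSpace 𝓘(ℝ, E) x))
    {θ : Π x : M, TangentSpace 𝓘(ℝ, E) x →L[ℝ] ℝ} {U : Π x : M, TangentSpace 𝓘(ℝ, E) x}
    (hU : IsSmoothField U) (hθ : IsSmoothOneForm θ) (hθg : ∀ x v, θ x v = g.inner x v (U x))
    (hclosed : ∀ x, extDer θ x = 0)
    (hK : ∀ (x : M) (v w : E),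
      fderiv ℝ (chartBilin g.inner x) (extChartAt 𝓘(ℝ, E) x x) (U x) v w +
      g.inner x (fderiv ℝ (chartField U x) (extChartAt 𝓘(ℝ, E) x x) v) w +
      g.inner x v (fderiv ℝ (chartField U x) (extChartAt 𝓘(ℝ, E) x x) w) = 0) :
    IsParallel g U := by
  obtain ⟨Γ, hΓ, hLC⟩ := exists_isLeviCivita g
  refine ⟨_, hLC, fun x ↦ ?_⟩
  have hUd := differentiableAt_chartField ((hU x).mdifferentiableAt (by simp))
  have hθd := (isSmoothFormAt_iff.1 (hθ x)).differentiableAt (by simp)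
  ext v
  have := fderiv_add_christoffel_eq_zero (G := chartBilin g.inner x) (α := chartForm θ x)
    (u := chartField U x) (q := extChartAt 𝓘(ℝ, E) x x) (Γ := Γ x)
    (fun v hv ↦ by rw [chartBilin_center]; exact g.pos x v hv)
    (fun y v w ↦ g.symm _ _ _) hUd hθd
    ((isSmoothBilinAt_iff.1 (g.contMDiff x)).differentiableAt (by simp)) (hΓ x)
    (by
      filter_upwards [eventually_mem_chart_target x] with y hy v
      rw [chartForm_apply, chartBilin_apply, chartFrame_chartField U hy]
      exact hθg _ _)
    (fun v w ↦ by
      have h1 : extDer θ x ![v, w] = 0 := congr($(hclosed x) ![v, w])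
      exact sub_eq_zero.1 ((extDer_apply hθd v w).symm.trans h1))
    (fun v w ↦ by
      rw [chartField_center, chartBilin_center]
      exact hK x v w) v
  rw [chartField_center] at this
  exact this

end LeviCivita

/-! ### Local sections, and transport along integral curves. -/

section Submersions

set_option maxSynthPendingDepth 3

variable {E : Type*} [NormedAddCommGroup E] [NormedSpace ℝ E]
  {M : Type*} [TopologicalSpace M] [ChartedSpace E M]
  {E' : Type*} [NormedAddCommGroup E'] [NormedSpace ℝ E']
  {N : Type*} [TopologicalSpace N] [ChartedSpace E' N]

/-- A submersion has local sections through every point. -/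
lemma exists_local_section {p : M → N}
    (hp : Manifold.IsSubmersion 𝓘(ℝ, E) 𝓘(ℝ, E') ∞ p) (x : M) :
    ∃ s : N → M, ContMDiffAt 𝓘(ℝ, E') 𝓘(ℝ, E) ∞ s (p x) ∧ s (p x) = x ∧
      ∀ᶠ u in 𝓝 (p x), p (s u) = u := by
  have h := hp.isSubmersionOfComplement_complement.isSubmersionAt x
  let φ := h.domChart
  let ψ := h.codChart
  let e := h.equiv
  have hφx : x ∈ φ.source := h.mem_domChart_source
  have hψx : p x ∈ ψ.source := h.mem_codChart_source
  have hw (z : E) (hz : z ∈ φ.target) : ψ (p (φ.symm z)) = (e z).1 := by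
    have hz' : z ∈ (φ.extend 𝓘(ℝ, E)).target := by simpa using hz
    exact h.writtenInCharts hz'
  -- In the adapted charts `p` is a linear projection; the section freezes the complementary
  -- coordinate at its value at `x`.
  let c : N → E := fun u ↦ e.symm (ψ u, (e (φ x)).2)
  have hcx : c (p x) = φ x := by
    have := hw (φ x) (φ.map_source hφx)
    rw [φ.left_inv hφx] at this
    simp only [c, this, Prod.mk.eta, ContinuousLinearEquiv.symm_apply_apply]
  have hc : ContMDiffAt 𝓘(ℝ, E') 𝓘(ℝ, E) ∞ c (p x) := by
    have h1 : ContMDiffAt 𝓘(ℝ, E') 𝓘(ℝ, E') ∞ ψ (p x) :=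
      contMDiffAt_of_mem_maximalAtlas h.codChart_mem_maximalAtlas hψx
    exact e.symm.contDiff.contMDiff.contMDiffAt.comp (p x)
      (h1.prodMk_space contMDiffAt_const)
  have hct : ∀ᶠ u in 𝓝 (p x), c u ∈ φ.target :=
    hc.continuousAt.eventually_mem (φ.open_target.mem_nhds (hcx ▸ φ.map_source hφx))
  refine ⟨fun u ↦ φ.symm (c u), ?_, ?_, ?_⟩
  · refine ContMDiffAt.comp (p x) ?_ hc
    exact contMDiffAt_symm_of_mem_maximalAtlas h.domChart_mem_maximalAtlas
      (hcx ▸ φ.map_source hφx)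
  · change φ.symm (c (p x)) = x
    rw [hcx, φ.left_inv hφx]
  · filter_upwards [hct, ψ.open_source.mem_nhds hψx] with u hu hu'
    refine ψ.injOn (h.source_subset_preimage_source (φ.map_target hu)) hu' ?_
    rw [hw _ hu]
    simp [c]

/-- Differentiating `p ∘ s = id` for a local section `s` gives a right inverse of `dp`. -/
lemma surjective_mfderiv_of_isSubmersion {p : M → N}
    (hp : Manifold.IsSubmersion 𝓘(ℝ, E) 𝓘(ℝ, E') ∞ p) (hps : ContMDiff 𝓘(ℝ, E) 𝓘(ℝ, E') ∞ p)
    (x : M) : Function.Surjective (mfderiv 𝓘(ℝ, E) 𝓘(ℝ, E') p x) := by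
  obtain ⟨s, hs, hsx, hps'⟩ := exists_local_section hp x
  have h1 : MDifferentiableAt 𝓘(ℝ, E) 𝓘(ℝ, E') p (s (p x)) :=
    (hps _).mdifferentiableAt (by simp)
  have h2 : mfderiv 𝓘(ℝ, E') 𝓘(ℝ, E') (p ∘ s) (p x) = ContinuousLinearMap.id ℝ E' := by
    rw [Filter.EventuallyEq.mfderiv_eq (f₁ := p ∘ s) (f := id) hps', mfderiv_id]
    rfl
  rw [mfderiv_comp (p x) h1 (hs.mdifferentiableAt (by simp)), hsx] at h2
  intro v
  exact ⟨mfderiv 𝓘(ℝ, E') 𝓘(ℝ, E) s (p x) v, congr($h2 v)⟩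

lemma hasDerivAt_chart_of_hasMFDerivAt [IsManifold 𝓘(ℝ, E) ∞ M] {γ : ℝ → M} {t : ℝ} {u : E}
    (hγ : HasMFDerivAt 𝓘(ℝ, ℝ) 𝓘(ℝ, E) γ t ((1 : ℝ →L[ℝ] ℝ).smulRight u)) :
    HasDerivAt (fun s ↦ extChartAt 𝓘(ℝ, E) (γ t) (γ s)) u t := by
  have h1 := (mdifferentiableAt_extChartAt (I := 𝓘(ℝ, E)) (mem_chart_source E (γ t))).hasMFDerivAt
  rw [mfderiv_extChartAt_self] at h1
  have h2 := hasMFDerivAt_iff_hasFDerivAt.1 (h1.comp t hγ)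
  have h3 : HasFDerivAt (fun s ↦ extChartAt 𝓘(ℝ, E) (γ t) (γ s))
    ((1 : ℝ →L[ℝ] ℝ).smulRight u) t := h2
  simpa using h3.hasDerivAt

/-- A map which is constant along integral curves is annihilated by the vector field. -/
lemma mfderiv_apply_eq_zero_of_const {p : M → N} {U : Π x : M, TangentSpace 𝓘(ℝ, E) x} {γ : ℝ → M}
    {t : ℝ} (hp : MDifferentiableAt 𝓘(ℝ, E) 𝓘(ℝ, E') p (γ t)) (hγ : IsMIntegralCurve γ U)
    (hc : ∀ s, p (γ s) = p (γ t)) : mfderiv 𝓘(ℝ, E) 𝓘(ℝ, E') p (γ t) (U (γ t)) = 0 := by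
  have h1 := (hp.hasMFDerivAt.comp t (hγ t)).mfderiv
  have h2 : p ∘ γ = fun _ ↦ p (γ t) := funext hc
  rw [h2, mfderiv_const] at h1
  have h3 (u : E) : (1 : ℝ →L[ℝ] ℝ).smulRight u (1 : ℝ) = u := by simp
  exact (congrArg (mfderiv 𝓘(ℝ, E) 𝓘(ℝ, E') p (γ t)) (h3 (U (γ t)))).symm.trans
    congr($(h1.symm) (1 : ℝ))

variable [IsManifold 𝓘(ℝ, E) ∞ M] [IsManifold 𝓘(ℝ, E') ∞ N]
  [FiniteDimensional ℝ E] [FiniteDimensional ℝ E'] [CompleteSpace E]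

/-- A `1`-form on the quotient representing an invariant form is constant along the integral
curves. -/
lemma eq_of_isMIntegralCurve {p : M → N} {U : Π x : M, TangentSpace 𝓘(ℝ, E) x}
    {η : Π x : M, TangentSpace 𝓘(ℝ, E) x →L[ℝ] ℝ} {β : M → E' →L[ℝ] ℝ}
    (hp : ContMDiff 𝓘(ℝ, E) 𝓘(ℝ, E') ∞ p)
    (hsurj : ∀ x, Function.Surjective (mfderiv 𝓘(ℝ, E) 𝓘(ℝ, E') p x))
    (hpU : ∀ x, mfderiv 𝓘(ℝ, E) 𝓘(ℝ, E') p x (U x) = 0) (hU : IsSmoothField U)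
    (hη : IsSmoothOneForm η) (hηU : ∀ x, η x (U x) = 0)
    (hint : ∀ x, (extDer η x).curryLeft (U x) = 0)
    (hβ : ∀ x v, β x (mfderiv 𝓘(ℝ, E) 𝓘(ℝ, E') p x v) = η x v)
    {γ : ℝ → M} (hγ : IsMIntegralCurve γ U) (hc : ∀ s t, p (γ s) = p (γ t)) (s t : ℝ) :
    β (γ s) = β (γ t) := by
  -- The chart stays centred at `γ t` while `s` varies near `t`. In it, `η` and `dp` obey the same
  -- equation: `hA` expresses `L_U η = 0`, and `hB` comes from differentiating `dp(U) = 0`.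
  have hd (t : ℝ) : HasDerivAt (fun s ↦ β (γ s)) 0 t := by
    let q : ℝ → E := fun s ↦ extChartAt 𝓘(ℝ, E) (γ t) (γ s)
    let P : E → E' := chartMap E E' p (γ t)
    have hq : HasDerivAt q (U (γ t)) t := hasDerivAt_chart_of_hasMFDerivAt (hγ t)
    have hUd := differentiableAt_chartField ((hU (γ t)).mdifferentiableAt (by simp))
    have hηd := (isSmoothFormAt_iff.1 (hη (γ t))).differentiableAt (by simp)
    have hP := contDiffAt_chartMap (hp (γ t))
    have hA : HasDerivAt (fun s ↦ chartForm η (γ t) (q s))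
        (-(chartForm η (γ t) (q t) ∘L fderiv ℝ (chartField U (γ t)) (q t))) t := by
      have h := hηd.hasFDerivAt.comp_hasDerivAt t hq
      refine h.congr_deriv ?_
      ext v
      have h1 := fderiv_form_add_eq_zero (c := 0) hηd hUd (by
        filter_upwards [eventually_mem_chart_target (γ t)] with y hy
        rw [chartForm_apply, chartFrame_chartField U hy]
        exact hηU _) (by
        rw [chartField_center]
        exact fderiv_chartForm_swap_of_curryLeft hηd (hint _)) v
      rw [chartField_center] at h1
      exact eq_neg_of_add_eq_zero_left h1
    have hB : HasDerivAt (fun s ↦ fderiv ℝ P (q s))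
        (-(fderiv ℝ P (q t) ∘L fderiv ℝ (chartField U (γ t)) (q t))) t := by
      have h := ((contDiffAt_fderiv_chartMap (hp (γ t))).differentiableAt
        (by simp)).hasFDerivAt.comp_hasDerivAt t hq
      refine h.congr_deriv ?_
      ext v
      have h1 := fderiv_fderiv_add_eq_zero hP hUd (fderiv_chartMap_chartField (hp (γ t)) hpU) v
      rw [chartField_center] at h1
      exact eq_neg_of_add_eq_zero_left h1
    refine hasDerivAt_zero_of_comp ?_ hA hB ?_
    · have hγc : ContinuousAt γ t := (hγ t).continuousAt
      filter_upwards [hq.continuousAt.eventually (eventually_chartMap (hp (γ t))),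
        hγc.eventually_mem (extChartAt_source_mem_nhds (I := 𝓘(ℝ, E)) (γ t))] with s hs hs'
      have hinv : (extChartAt 𝓘(ℝ, E) (γ t)).symm (q s) = γ s :=
        (extChartAt 𝓘(ℝ, E) (γ t)).left_inv hs'
      -- As `p ∘ γ` is constant, the curve stays over the centre of the chart of `N`, where the
      -- frame is the identity.
      have hPq : chartMap E E' p (γ t) (q s) = extChartAt 𝓘(ℝ, E') (p (γ t)) (p (γ t)) := by
        change extChartAt 𝓘(ℝ, E') (p (γ t)) (p ((extChartAt 𝓘(ℝ, E) (γ t)).symm (q s))) = _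
        rw [hinv, hc s t]
      ext v
      have h1 := hs.2 v
      rw [hPq, chartFrame_center] at h1
      have h2 := hβ ((extChartAt 𝓘(ℝ, E) (γ t)).symm (q s)) (chartFrame (γ t) (q s) v)
      exact h2.symm.trans
        (congrArg₂ (fun (b : E' →L[ℝ] ℝ) z ↦ b z) (congrArg β hinv) h1.symm)
    · have : q t = extChartAt 𝓘(ℝ, E) (γ t) (γ t) := rfl
      rw [this, show fderiv ℝ P (extChartAt 𝓘(ℝ, E) (γ t) (γ t)) = _ from
        fderiv_chartMap_center (hp (γ t))]
      exact hsurj _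
  exact is_const_of_deriv_eq_zero (fun t ↦ (hd t).differentiableAt) (fun t ↦ (hd t).deriv) s t

end Submersions

/-! ### Kernels of the projection and of `dη`. -/

section LinearAlgebra

variable {W W' : Type*} [AddCommGroup W] [Module ℝ W] [AddCommGroup W'] [Module ℝ W']
  [FiniteDimensional ℝ W]

/-- The kernel of a surjection lowering the dimension by one is spanned by any of its nonzero
elements. -/
lemma exists_eq_smul_of_apply_eq_zero [FiniteDimensional ℝ W'] {f : W →ₗ[ℝ] W'}
    (hf : Function.Surjective f) (hdim : Module.finrank ℝ W = Module.finrank ℝ W' + 1) {u : W}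
    (hu : u ≠ 0) (hfu : f u = 0) {v : W} (hv : f v = 0) : ∃ c : ℝ, c • u = v := by
  have h1 := f.finrank_range_add_finrank_ker
  rw [LinearMap.range_eq_top.2 hf, finrank_top] at h1
  have h2 : Module.finrank ℝ (LinearMap.ker f) = 1 := by omega
  obtain ⟨c, hc⟩ := (finrank_eq_one_iff_of_nonzero' (⟨u, hfu⟩ : LinearMap.ker f)
    (by simpa [Subtype.ext_iff] using hu)).1 h2 ⟨v, hv⟩
  exact ⟨c, congrArg Subtype.val hc⟩

/-- Uniqueness of the Reeb vector. -/
lemma eq_apply_of_formRank {n : ℕ} {b : W' [⋀^Fin 2]→ₗ[ℝ] ℝ} {f : W →ₗ[ℝ] W'} {a : W' →ₗ[ℝ] ℝ}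
    (hf : Function.Surjective f) (hdim : Module.finrank ℝ W = 2 * n + 2)
    (hrank : formRank (b.compLinearMap f) = 2 * n) {u v : W} {z : W'} (hu : u ≠ 0) (hfu : f u = 0)
    (hv : (b.compLinearMap f).curryLeft v = 0) (hav : a (f v) = 1) (hz : b.curryLeft z = 0)
    (haz : a z = 1) : z = f v := by
  obtain ⟨w, rfl⟩ := hf z
  have hker {w : W} (hw : b.curryLeft (f w) = 0) :
      w ∈ LinearMap.ker (b.compLinearMap f).curryLeft := by
    ext m
    have h1 := congr($hw (f ∘ m))
    refine Eq.trans ?_ h1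
    change b (f ∘ Matrix.vecCons w m) = b (Matrix.vecCons (f w) (f ∘ m))
    congr 1
    ext i
    refine Fin.cases rfl (fun j ↦ rfl) i
  have hli : LinearIndependent ℝ ![u, v] := by
    rw [LinearIndependent.pair_iff]
    intro c d hcd
    have hd : d = 0 := by
      have := congrArg (fun w ↦ a (f w)) hcd
      simpa [hfu, hav] using this
    subst hd
    simpa [hu] using hcd
  -- Rank `2n` in dimension `2n + 2` leaves a kernel of dimension 2.
  have hspan : Submodule.span ℝ (Set.range ![u, v]) =
      LinearMap.ker (b.compLinearMap f).curryLeft := by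
    refine Submodule.eq_of_le_of_finrank_eq ?_ ?_
    · rw [Submodule.span_le]
      rintro _ ⟨i, rfl⟩
      fin_cases i
      · exact hker (by simp [hfu])
      · exact hv
    · rw [finrank_span_eq_card hli]
      have := (b.compLinearMap f).curryLeft.finrank_range_add_finrank_ker
      rw [formRank] at hrank
      simp
      omega
  have hw := hker hz
  rw [← hspan, Matrix.range_cons, Matrix.range_cons, Matrix.range_empty, Set.union_empty,
    Set.singleton_union, Submodule.mem_span_pair] at hw
  obtain ⟨c, d, rfl⟩ := hw
  have hd : d = 1 := by simpa [hfu, hav] using haz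
  simp [hfu, hd]

end LinearAlgebra

/-! ### Descent of the contact form and of the Reeb field. -/

section Quotient

set_option maxSynthPendingDepth 3

variable {E : Type*} [NormedAddCommGroup E] [NormedSpace ℝ E]
  {M : Type*} [TopologicalSpace M] [ChartedSpace E M] [IsManifold 𝓘(ℝ, E) ∞ M]
  {E' : Type*} [NormedAddCommGroup E'] [NormedSpace ℝ E']
  {N : Type*} [TopologicalSpace N] [ChartedSpace E' N] [IsManifold 𝓘(ℝ, E') ∞ N]
  {U : Π x : M, TangentSpace 𝓘(ℝ, E) x} {p : M → N}

omit [IsManifold 𝓘(ℝ, E) ∞ M] [IsManifold 𝓘(ℝ, E') ∞ N] in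
lemma IsOrbitManifold.contMDiff (hp : IsOrbitManifold (E' := E') U p) :
    ContMDiff 𝓘(ℝ, E) 𝓘(ℝ, E') ∞ p := hp.submersion.contMDiff

omit [IsManifold 𝓘(ℝ, E) ∞ M] [IsManifold 𝓘(ℝ, E') ∞ N] in
lemma IsOrbitManifold.surjective_mfderiv (hp : IsOrbitManifold (E' := E') U p) (x : M) :
    Function.Surjective (mfderiv 𝓘(ℝ, E) 𝓘(ℝ, E') p x) :=
  surjective_mfderiv_of_isSubmersion hp.submersion hp.contMDiff x

omit [IsManifold 𝓘(ℝ, E) ∞ M] [IsManifold 𝓘(ℝ, E') ∞ N] in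
lemma IsOrbitManifold.apply_curve (hp : IsOrbitManifold (E' := E') U p) {γ : ℝ → M}
    (hγ : IsMIntegralCurve (I := 𝓘(ℝ, E)) γ U) (s t : ℝ) : p (γ s) = p (γ t) := by
  have h (s : ℝ) : p (γ s) = p (γ 0) := by
    have : γ s ∈ p ⁻¹' {p (γ 0)} := by
      rw [hp.fibre]
      exact ⟨γ, s, hγ, rfl, rfl⟩
    exact this
  rw [h s, h t]

omit [IsManifold 𝓘(ℝ, E) ∞ M] [IsManifold 𝓘(ℝ, E') ∞ N] in
lemma IsOrbitManifold.exists_curve (hp : IsOrbitManifold (E' := E') U p) {x y : M}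
    (h : p y = p x) : ∃ (γ : ℝ → M) (t : ℝ), IsMIntegralCurve (I := 𝓘(ℝ, E)) γ U ∧ γ 0 = x ∧
      γ t = y := by
  have : y ∈ p ⁻¹' {p x} := h
  rwa [hp.fibre] at this

omit [IsManifold 𝓘(ℝ, E) ∞ M] [IsManifold 𝓘(ℝ, E') ∞ N] in
lemma IsOrbitManifold.mfderiv_apply_field (hp : IsOrbitManifold (E' := E') U p) (x : M) :
    mfderiv 𝓘(ℝ, E) 𝓘(ℝ, E') p x (U x) = 0 := by
  obtain ⟨γ, t, hγ, -, rfl⟩ := hp.exists_curve (x := x) rfl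
  exact mfderiv_apply_eq_zero_of_const ((hp.contMDiff _).mdifferentiableAt (by simp)) hγ
    fun s ↦ hp.apply_curve hγ s t

/-- A `1`-form is recovered from its pullback along a submersion by a local section. -/
lemma eventuallyEq_pullback_section {s : N → M} {y : N}
    (hp : ContMDiff 𝓘(ℝ, E) 𝓘(ℝ, E') ∞ p) (hs : ContMDiffAt 𝓘(ℝ, E') 𝓘(ℝ, E) ∞ s y)
    (hps : ∀ᶠ u in 𝓝 y, p (s u) = u) (α : Π y : N, TangentSpace 𝓘(ℝ, E') y →L[ℝ] ℝ) :
    ∀ᶠ u in 𝓝 y, α u = pullback s (pullback (E := E) p α) u := by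
  have h1 : ∀ᶠ x in 𝓝 y, ContMDiffAt 𝓘(ℝ, E') 𝓘(ℝ, E) 1 s x :=
    (contMDiffAt_iff_contMDiffAt_nhds (by simp)).1 (hs.of_le (by simp))
  filter_upwards [h1, eventually_eventually_nhds.2 hps] with u hu hpu
  have hd : (mfderiv 𝓘(ℝ, E') 𝓘(ℝ, E') (p ∘ s) u : E' →L[ℝ] E') = ContinuousLinearMap.id ℝ E' := by
    rw [Filter.EventuallyEq.mfderiv_eq (f₁ := p ∘ s) (f := id) hpu, mfderiv_id]
    rfl
  have hd' (v : E') : mfderiv 𝓘(ℝ, E) 𝓘(ℝ, E') p (s u) (mfderiv 𝓘(ℝ, E') 𝓘(ℝ, E) s u v) = v := by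
    have h2 := mfderiv_comp u ((hp (s u)).mdifferentiableAt (by simp))
      (hu.mdifferentiableAt one_ne_zero)
    exact congr($(h2.symm.trans hd) v)
  ext v
  exact (form_congr α hpu.self_of_nhds (hd' v)).symm

variable [FiniteDimensional ℝ E] [FiniteDimensional ℝ E'] [CompleteSpace E]

/-- A `1`-form `η` with `η(U) = 0` and `i_U dη = 0` descends to the space of orbits of `U`. -/
lemma IsOrbitManifold.exists_form (hp : IsOrbitManifold (E' := E') U p) (hU : IsSmoothField U)
    (hU0 : ∀ x, U x ≠ 0) (hdim : Module.finrank ℝ E = Module.finrank ℝ E' + 1)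
    {η : Π x : M, TangentSpace 𝓘(ℝ, E) x →L[ℝ] ℝ} (hη : IsSmoothOneForm η)
    (hηU : ∀ x, η x (U x) = 0) (hint : ∀ x, (extDer η x).curryLeft (U x) = 0) :
    ∃ ηN : Π y : N, TangentSpace 𝓘(ℝ, E') y →L[ℝ] ℝ,
      IsSmoothOneForm ηN ∧ pullback p ηN = η := by
  have hex (x : M) : ∃ b : E' →L[ℝ] ℝ, ∀ v, b (mfderiv 𝓘(ℝ, E) 𝓘(ℝ, E') p x v) = η x v := by
    obtain ⟨L, hL⟩ : ∃ L : E →L[ℝ] E', L = mfderiv 𝓘(ℝ, E) 𝓘(ℝ, E') p x := ⟨_, rfl⟩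
    have hLs : Function.Surjective L := hL ▸ hp.surjective_mfderiv x
    have hLU : L (U x) = 0 := hL ▸ hp.mfderiv_apply_field x
    obtain ⟨R, hR⟩ := L.exists_rightInverse_of_surjective (LinearMap.range_eq_top.2 hLs)
    have hRz (z : E') : L (R z) = z := congr($hR z)
    refine ⟨(η x : E →L[ℝ] ℝ) ∘L R, fun (v : E) ↦ ?_⟩
    rw [← hL]
    -- `R (L v)` and `v` differ by a multiple of `U x`, on which `η` vanishes, so `η ∘ R` does not
    -- depend on the chosen lift.
    have hker : L.toLinearMap (R (L v) - v) = 0 := by simp [hRz]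
    obtain ⟨c, hc⟩ := exists_eq_smul_of_apply_eq_zero (W := E) (f := L.toLinearMap) hLs hdim (hU0 x)
      hLU hker
    have h1 : (η x : E →L[ℝ] ℝ) (R (L v) - v) = 0 := by
      rw [← hc]
      exact (map_smul (η x) c (U x)).trans (by rw [hηU, smul_zero])
    exact sub_eq_zero.1 ((map_sub (η x : E →L[ℝ] ℝ) (R (L v)) v).symm.trans h1)
  choose β hβ using hex
  have hβp {x y : M} (h : p y = p x) : β y = β x := by
    obtain ⟨γ, t, hγ, rfl, rfl⟩ := hp.exists_curve h
    exact eq_of_isMIntegralCurve hp.contMDiff hp.surjective_mfderiv hp.mfderiv_apply_field hU hη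
      hηU hint hβ hγ (fun s t ↦ hp.apply_curve hγ s t) t 0
  let ηN : Π y : N, TangentSpace 𝓘(ℝ, E') y →L[ℝ] ℝ :=
    fun y ↦ β (Function.surjInv hp.surjective y)
  have hpull : pullback p ηN = η := by
    ext x v
    have h1 : β (Function.surjInv hp.surjective (p x)) = β x :=
      hβp (Function.surjInv_eq hp.surjective (p x))
    exact congr($h1 (mfderiv 𝓘(ℝ, E) 𝓘(ℝ, E') p x v)).trans (hβ x v)
  refine ⟨ηN, fun y ↦ ?_, hpull⟩
  obtain ⟨x, rfl⟩ := hp.surjective y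
  obtain ⟨s, hs, hsx, hps⟩ := exists_local_section hp.submersion x
  -- Near `p x`, `ηN` coincides with `s^*η`, which is smooth.
  have h1 : IsSmoothFormAt (pullback s η) (p x) := IsSmoothFormAt.pullback hs (hη _)
  refine h1.congr ?_
  rw [← hpull]
  exact eventuallyEq_pullback_section hp.contMDiff hs hps ηN

omit [FiniteDimensional ℝ E] [FiniteDimensional ℝ E'] [CompleteSpace E] in
lemma extDer_pullback_apply (hp : ContMDiff 𝓘(ℝ, E) 𝓘(ℝ, E') ∞ p)
    {η : Π x : M, TangentSpace 𝓘(ℝ, E) x →L[ℝ] ℝ} {ηN : Π y : N, TangentSpace 𝓘(ℝ, E') y →L[ℝ] ℝ}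
    (hηN : IsSmoothOneForm ηN) (hpull : pullback p ηN = η) (x : M) :
    extDer η x =
      (extDer ηN (p x)).compLinearMap (mfderiv 𝓘(ℝ, E) 𝓘(ℝ, E') p x).toLinearMap := by
  rw [← hpull]
  exact extDer_pullback (hp x) (hηN _)

omit [FiniteDimensional ℝ E] [FiniteDimensional ℝ E'] [CompleteSpace E] in
/-- The form induced by the anti-Lee form is a contact form. -/
lemma isContactForm_of_pullback (hp : ContMDiff 𝓘(ℝ, E) 𝓘(ℝ, E') ∞ p)
    (hps : Function.Surjective p) {n : ℕ} {θ η : Π x : M, TangentSpace 𝓘(ℝ, E) x →L[ℝ] ℝ}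
    (hM : IsLCSFirstKind n θ η) (hdim : Module.finrank ℝ E' = 2 * n + 1)
    {ηN : Π y : N, TangentSpace 𝓘(ℝ, E') y →L[ℝ] ℝ}
    (hηN : IsSmoothOneForm ηN) (hpull : pullback p ηN = η) : IsContactForm n ηN where
  dim := hdim
  smooth := hηN
  volume y := by
    obtain ⟨x, rfl⟩ := hps y
    intro h0
    refine hM.volume x (wedge_wedge_eq_zero ?_)
    have h1 : (η x).toLinearMap =
        (ηN (p x)).toLinearMap ∘ₗ (mfderiv 𝓘(ℝ, E) 𝓘(ℝ, E') p x).toLinearMap := by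
      rw [← hpull]; rfl
    rw [extDer_pullback_apply hp hηN hpull x, h1, toForm_comp, wedgePow_compLinearMap,
      wedge_compLinearMap, h0]
    rfl

omit [FiniteDimensional ℝ E'] [CompleteSpace E] in
/-- The anti-Lee field projects to the Reeb field. -/
lemma IsOrbitManifold.exists_reeb (hp : IsOrbitManifold (E' := E') U p)
    {n : ℕ} {θ η : Π x : M, TangentSpace 𝓘(ℝ, E) x →L[ℝ] ℝ} {V : Π x : M, TangentSpace 𝓘(ℝ, E) x}
    (hM : IsLCSFirstKind n θ η) (hU0 : ∀ x, U x ≠ 0) (hV : IsAntiLeeField θ η V)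
    {ηN : Π y : N, TangentSpace 𝓘(ℝ, E') y →L[ℝ] ℝ}
    (hηN : IsSmoothOneForm ηN) (hpull : pullback p ηN = η) :
    ∃ ξ : Π y : N, TangentSpace 𝓘(ℝ, E') y, ProjectsTo p V ξ ∧ IsReebField ηN ξ := by
  have hdp (x : M) : extDer η x =
      (extDer ηN (p x)).compLinearMap (mfderiv 𝓘(ℝ, E) 𝓘(ℝ, E') p x).toLinearMap :=
    extDer_pullback_apply hp.contMDiff hηN hpull x
  have hηV (x : M) : ηN (p x) (mfderiv 𝓘(ℝ, E) 𝓘(ℝ, E') p x (V x)) = 1 := by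
    have : pullback p ηN x (V x) = 1 := by rw [hpull, hV.antiLee]
    exact this
  have hint (x : M) : (extDer ηN (p x)).curryLeft (mfderiv 𝓘(ℝ, E) 𝓘(ℝ, E') p x (V x)) = 0 := by
    ext m
    have h1 := hV.interior x
    rw [hdp x] at h1
    choose r hr using hp.surjective_mfderiv x
    have h2 := congr($h1 (fun i ↦ r (m i)))
    refine Eq.trans ?_ h2
    change extDer ηN (p x) _ = extDer ηN (p x) _
    congr 1
    ext i
    refine Fin.cases rfl (fun j ↦ (hr (m j)).symm) i
  -- Both vectors solve the Reeb equations at the same point of `N`, and the solution is unique.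
  have hV_eq (x x' : M) (h : p x' = p x) :
      (mfderiv 𝓘(ℝ, E) 𝓘(ℝ, E') p x' (V x') : E') = mfderiv 𝓘(ℝ, E) 𝓘(ℝ, E') p x (V x) := by
    have hz (y : N) (h : p x' = y) : ηN y (mfderiv 𝓘(ℝ, E) 𝓘(ℝ, E') p x' (V x') : E') = 1 ∧
        (extDer ηN y).curryLeft (mfderiv 𝓘(ℝ, E) 𝓘(ℝ, E') p x' (V x') : E') = 0 := by
      subst h
      exact ⟨hηV x', hint x'⟩
    have : FiniteDimensional ℝ (TangentSpace 𝓘(ℝ, E) x) := inferInstanceAs (FiniteDimensional ℝ E)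
    exact eq_apply_of_formRank (W := TangentSpace 𝓘(ℝ, E) x)
      (W' := TangentSpace 𝓘(ℝ, E') (p x)) (n := n) (b := extDer ηN (p x))
      (f := (mfderiv 𝓘(ℝ, E) 𝓘(ℝ, E') p x).toLinearMap) (a := (ηN (p x)).toLinearMap) (u := U x)
      (hp.surjective_mfderiv x) hM.dim ((congrArg formRank (hdp x)).symm.trans (hM.rank x)) (hU0 x)
      (hp.mfderiv_apply_field x)
      ((congrArg (fun b ↦ b.curryLeft (V x)) (hdp x)).symm.trans (hV.interior x)) (hηV x)
      (hz _ h).2 (hz _ h).1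
  let ξ : Π y : N, TangentSpace 𝓘(ℝ, E') y := fun y ↦
    (mfderiv 𝓘(ℝ, E) 𝓘(ℝ, E') p (Function.surjInv hp.surjective y)
      (V (Function.surjInv hp.surjective y)) : E')
  have hξ : ProjectsTo p V ξ := fun x ↦
    (hV_eq x _ (Function.surjInv_eq hp.surjective (p x))).symm
  refine ⟨ξ, hξ, ?_, ?_, ?_⟩
  · intro y
    obtain ⟨x, rfl⟩ := hp.surjective y
    obtain ⟨s, hs, hsx, hps⟩ := exists_local_section hp.submersion x
    have h1 : ContMDiff (𝓘(ℝ, E).prod 𝓘(ℝ, E)) (𝓘(ℝ, E').prod 𝓘(ℝ, E')) ∞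
        (tangentMap 𝓘(ℝ, E) 𝓘(ℝ, E') p) := hp.contMDiff.contMDiff_tangentMap (by simp)
    -- Locally `ξ = dp ∘ V ∘ s`, a composite of smooth maps.
    have h2 := (h1.contMDiffAt.comp _ (hV.smooth (s (p x)))).comp (p x) hs
    refine h2.congr_of_eventuallyEq ?_
    filter_upwards [hps] with u hu
    have h3 : (TotalSpace.mk' E' (p (s u)) (ξ (p (s u))) : TangentBundle 𝓘(ℝ, E') N) =
        TotalSpace.mk' E' u (ξ u) := by rw [hu]
    rw [← h3, ← hξ (s u)]
    rfl
  · intro y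
    obtain ⟨x, rfl⟩ := hp.surjective y
    rw [← hξ x]
    exact hηV x
  · intro y
    obtain ⟨x, rfl⟩ := hp.surjective y
    rw [← hξ x]
    exact hint x

end Quotient

/-! ### Existence of Riemannian metrics. -/

section Metric

set_option maxSynthPendingDepth 3

/-- On the compact unit sphere `g v v` has a positive minimum, and homogeneity turns it into a lower
bound by a multiple of `‖v‖ ^ 2`. This supplies the boundedness field of a
`ContMDiffRiemannianMetric`. -/
lemma isVonNBounded_of_pos {E : Type*} [NormedAddCommGroup E] [NormedSpace ℝ E]
    [FiniteDimensional ℝ E] (g : E →L[ℝ] E →L[ℝ] ℝ) (hg : ∀ v, v ≠ 0 → 0 < g v v) :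
    Bornology.IsVonNBounded ℝ {v : E | g v v < 1} := by
  have := FiniteDimensional.proper_real E
  rw [NormedSpace.isVonNBounded_iff]
  rcases subsingleton_or_nontrivial E with h | h
  · exact (Set.subsingleton_of_subsingleton (s := _)).finite.isBounded
  obtain ⟨v₀, hv₀, hmin⟩ := (isCompact_sphere (0 : E) 1).exists_isMinOn
    (NormedSpace.sphere_nonempty.2 zero_le_one) (f := fun v ↦ g v v)
    (g.continuous.clm_apply continuous_id).continuousOn
  have hm : 0 < g v₀ v₀ := hg v₀ (by rintro rfl; simp at hv₀)
  have hbound (v : E) : g v₀ v₀ * ‖v‖ ^ 2 ≤ g v v := by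
    rcases eq_or_ne v 0 with rfl | hv
    · simp
    have hn : 0 < ‖v‖ := norm_pos_iff.2 hv
    have h1 : g v₀ v₀ ≤ g (‖v‖⁻¹ • v) (‖v‖⁻¹ • v) :=
      hmin (by simp [norm_smul, hn.ne'])
    simp only [map_smul, smul_apply, smul_eq_mul] at h1
    calc g v₀ v₀ * ‖v‖ ^ 2 ≤ ‖v‖⁻¹ * (‖v‖⁻¹ * g v v) * ‖v‖ ^ 2 := by gcongr
      _ = g v v := by field_simp
  -- The radius avoids a square root: `2‖v‖ ≤ ‖v‖² + 1`.
  refine (Metric.isBounded_closedBall (x := (0 : E)) (r := (g v₀ v₀)⁻¹ + 1)).subset fun v hv ↦ ?_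
  have hv' : g v₀ v₀ * ‖v‖ ^ 2 < 1 := (hbound v).trans_lt hv
  have h2 : ‖v‖ ^ 2 < (g v₀ v₀)⁻¹ := by
    rw [← one_div, lt_div_iff₀ hm]; linarith
  have h3 : 0 < (g v₀ v₀)⁻¹ := inv_pos.2 hm
  rw [mem_closedBall_zero_iff]
  nlinarith [sq_nonneg (‖v‖ - 1), norm_nonneg v]

variable {E : Type*} [NormedAddCommGroup E] [NormedSpace ℝ E]
  {M : Type*} [TopologicalSpace M] [ChartedSpace E M] [IsManifold 𝓘(ℝ, E) ∞ M]

/-- The constant field of bilinear forms on a vector space. -/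
def constBilin (B : E →L[ℝ] E →L[ℝ] ℝ) :
    Π x : E, TangentSpace 𝓘(ℝ, E) x →L[ℝ] TangentSpace 𝓘(ℝ, E) x →L[ℝ] ℝ := fun _ ↦ B

lemma isSmoothBilinAt_constBilin (B : E →L[ℝ] E →L[ℝ] ℝ) (x : E) :
    IsSmoothBilinAt (constBilin B) x := by
  have h : chartBilin (constBilin B) x = fun _ ↦ B := by
    ext y v w
    have aux (f : E → E) (hf : f = id) (v : E) : (mfderiv 𝓘(ℝ, E) 𝓘(ℝ, E) f y v : E) = v := by
      subst hf
      rw [mfderiv_id]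
      rfl
    have hid : ((extChartAt 𝓘(ℝ, E) x).symm : E → E) = id := by
      rw [extChartAt_model_space_eq_id]
      rfl
    exact congrArg₂ (fun v w ↦ B v w) (aux _ hid v) (aux _ hid w)
  rw [isSmoothBilinAt_iff, h]
  exact contDiffAt_const

/-- The existence of Riemannian metrics. -/
lemma exists_riemannian_bilin {F : Type*} [NormedAddCommGroup F] [InnerProductSpace ℝ F]
    [FiniteDimensional ℝ F] {N : Type*} [TopologicalSpace N] [ChartedSpace F N]
    [IsManifold 𝓘(ℝ, F) ∞ N] [T2Space N] [SigmaCompactSpace N] :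
    ∃ h : Π y : N, TangentSpace 𝓘(ℝ, F) y →L[ℝ] TangentSpace 𝓘(ℝ, F) y →L[ℝ] ℝ,
      (∀ y, IsSmoothBilinAt h y) ∧ (∀ y v w, h y v w = h y w v) ∧ ∀ y v, v ≠ 0 → 0 < h y v v := by
  let t (y : N) : Set (TangentSpace 𝓘(ℝ, F) y →L[ℝ] TangentSpace 𝓘(ℝ, F) y →L[ℝ] ℝ) :=
    {B | (∀ v w, B v w = B w v) ∧ ∀ v, v ≠ 0 → 0 < B v v}
  have ht (y : N) : Convex ℝ (t y) := by
    intro A hA B hB a b ha hb hab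
    refine ⟨fun v w ↦ ?_, fun v hv ↦ ?_⟩
    · change a * A v w + b * B v w = a * A w v + b * B w v
      rw [hA.1 v w, hB.1 v w]
    · change 0 < a * A v v + b * B v v
      have h1 := hA.2 v hv
      have h2 := hB.2 v hv
      rcases ha.eq_or_lt with rfl | ha
      · have : b = 1 := by linarith
        rw [this]; linarith
      · have := mul_pos ha h1
        have := mul_nonneg hb h2.le
        linarith
  -- Positive definite symmetric forms are a convex condition on each fibre, so a partition of unity
  -- glues the Euclidean inner products pulled back by charts.
  obtain ⟨s, hs⟩ := exists_contMDiffSection_forall_mem_convex_of_local (n := ⊤) 𝓘(ℝ, F)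
    (F_fiber := F →L[ℝ] F →L[ℝ] ℝ)
    (fun y : N ↦ TangentSpace 𝓘(ℝ, F) y →L[ℝ] TangentSpace 𝓘(ℝ, F) y →L[ℝ] ℝ) t ht (by
      intro y₀
      refine ⟨(chartAt F y₀).source, (chartAt F y₀).open_source.mem_nhds (mem_chart_source F y₀),
        pullbackBilin (extChartAt 𝓘(ℝ, F) y₀) (constBilin (innerSL ℝ (E := F))),
        fun y hy ↦ ?_, fun y hy ↦ ⟨fun v w ↦ real_inner_comm _ _, fun v hv ↦ ?_⟩⟩
      · have h1 : ContMDiffAt 𝓘(ℝ, F) 𝓘(ℝ, F) ∞ (extChartAt 𝓘(ℝ, F) y₀) y :=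
          contMDiffAt_extChartAt' hy
        have h2 : IsSmoothBilinAt (pullbackBilin (extChartAt 𝓘(ℝ, F) y₀)
            (constBilin (innerSL ℝ (E := F)))) y :=
          IsSmoothBilinAt.pullbackBilin h1 (isSmoothBilinAt_constBilin (innerSL ℝ (E := F)) _)
        exact ContMDiffAt.contMDiffWithinAt h2
      · obtain ⟨e, he⟩ := isInvertible_mfderiv_extChartAt (I := 𝓘(ℝ, F)) (x := y₀) (y := y)
          (by simpa using hy)
        refine real_inner_self_pos.2 ?_
        rw [← he]
        exact fun h0 ↦ hv ((map_eq_zero_iff e e.injective).1 h0))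
  exact ⟨fun y ↦ s y, fun y ↦ s.contMDiff y, fun y ↦ (hs y).1, fun y ↦ (hs y).2⟩

/-- The sum of a field of bilinear forms and the square of a `1`-form. -/
def addSq (h : Π x : M, TangentSpace 𝓘(ℝ, E) x →L[ℝ] TangentSpace 𝓘(ℝ, E) x →L[ℝ] ℝ)
    (θ : Π x : M, TangentSpace 𝓘(ℝ, E) x →L[ℝ] ℝ) :
    Π x : M, TangentSpace 𝓘(ℝ, E) x →L[ℝ] TangentSpace 𝓘(ℝ, E) x →L[ℝ] ℝ :=
  fun x ↦ h x + (θ x).smulRight (θ x)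

omit [IsManifold 𝓘(ℝ, E) ∞ M] in
lemma chartBilin_addSq (h : Π x : M, TangentSpace 𝓘(ℝ, E) x →L[ℝ] TangentSpace 𝓘(ℝ, E) x →L[ℝ] ℝ)
    (θ : Π x : M, TangentSpace 𝓘(ℝ, E) x →L[ℝ] ℝ) (x₀ : M) :
    chartBilin (addSq h θ) x₀ =
      fun y ↦ chartBilin h x₀ y + (chartForm θ x₀ y).smulRight (chartForm θ x₀ y) := rfl

lemma isSmoothBilinAt_addSq
    {h : Π x : M, TangentSpace 𝓘(ℝ, E) x →L[ℝ] TangentSpace 𝓘(ℝ, E) x →L[ℝ] ℝ}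
    {θ : Π x : M, TangentSpace 𝓘(ℝ, E) x →L[ℝ] ℝ} {x₀ : M} (hh : IsSmoothBilinAt h x₀)
    (hθ : IsSmoothFormAt θ x₀) : IsSmoothBilinAt (addSq h θ) x₀ := by
  rw [isSmoothBilinAt_iff] at hh ⊢
  rw [isSmoothFormAt_iff] at hθ
  rw [chartBilin_addSq]
  exact hh.add (hθ.smulRight hθ)

end Metric

/-! ### The metric `p^*h + θ ⊗ θ`. -/

section Parallel

set_option maxSynthPendingDepth 3

variable {E : Type*} [NormedAddCommGroup E] [NormedSpace ℝ E]
  {M : Type*} [TopologicalSpace M] [ChartedSpace E M] [IsManifold 𝓘(ℝ, E) ∞ M]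
  {F : Type*} [NormedAddCommGroup F] [InnerProductSpace ℝ F]
  {N : Type*} [TopologicalSpace N] [ChartedSpace F N] [IsManifold 𝓘(ℝ, F) ∞ N]
  {U : Π x : M, TangentSpace 𝓘(ℝ, E) x} {p : M → N}
  [FiniteDimensional ℝ E] [FiniteDimensional ℝ F] [CompleteSpace E]

/-- The metric `p^*h + θ ⊗ θ`, for which `U` is a parallel unit field with dual `1`-form `θ`. -/
lemma IsOrbitManifold.exists_metric [T2Space N] [SigmaCompactSpace N]
    (hp : IsOrbitManifold (E' := F) U p) (hU : IsSmoothField U)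
    (hdim : Module.finrank ℝ E = Module.finrank ℝ F + 1)
    {θ : Π x : M, TangentSpace 𝓘(ℝ, E) x →L[ℝ] ℝ} (hθ : IsSmoothOneForm θ)
    (hθU : ∀ x, θ x (U x) = 1) (hclosed : ∀ x, extDer θ x = 0) :
    ∃ g : ContMDiffRiemannianMetric 𝓘(ℝ, E) ∞ E (fun x : M ↦ TangentSpace 𝓘(ℝ, E) x),
      IsParallel g U ∧ (∀ x, g.inner x (U x) (U x) = 1) ∧
      ∀ (x : M) (v : TangentSpace 𝓘(ℝ, E) x), θ x v = g.inner x v (U x) := by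
  obtain ⟨h, hsm, hsymm, hpos⟩ := exists_riemannian_bilin (F := F) (N := N)
  let G := addSq (pullbackBilin p h) θ
  have hG (x : M) (v w : TangentSpace 𝓘(ℝ, E) x) : G x v w =
      h (p x) (mfderiv 𝓘(ℝ, E) 𝓘(ℝ, F) p x v) (mfderiv 𝓘(ℝ, E) 𝓘(ℝ, F) p x w) +
        θ x v * θ x w := rfl
  have hU0 (x : M) : U x ≠ 0 := by
    intro h0
    have := hθU x
    rw [h0, map_zero] at this
    exact zero_ne_one this
  have hGsm (x : M) : IsSmoothBilinAt G x :=
    isSmoothBilinAt_addSq (IsSmoothBilinAt.pullbackBilin (hp.contMDiff x) (hsm _)) (hθ x)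
  have hGpos (x : M) (v : TangentSpace 𝓘(ℝ, E) x) (hv : v ≠ 0) : 0 < G x v v := by
    rw [hG]
    -- Where `dp(v) = 0`, `v = c • U` with `c ≠ 0` and the form takes the value `c²`; elsewhere the
    -- term from `h` is positive.
    by_cases hv' : mfderiv 𝓘(ℝ, E) 𝓘(ℝ, F) p x v = 0
    · have : FiniteDimensional ℝ (TangentSpace 𝓘(ℝ, E) x) := inferInstanceAs (FiniteDimensional ℝ E)
      have : FiniteDimensional ℝ (TangentSpace 𝓘(ℝ, F) (p x)) :=
        inferInstanceAs (FiniteDimensional ℝ F)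
      obtain ⟨c, rfl⟩ := exists_eq_smul_of_apply_eq_zero (W := TangentSpace 𝓘(ℝ, E) x)
        (W' := TangentSpace 𝓘(ℝ, F) (p x))
        (f := (mfderiv 𝓘(ℝ, E) 𝓘(ℝ, F) p x).toLinearMap) (hp.surjective_mfderiv x) hdim (hU0 x)
        (hp.mfderiv_apply_field x) hv'
      have hc : c ≠ 0 := by rintro rfl; simp at hv
      rw [hv', map_zero, map_smul, hθU]
      change 0 < 0 + c • (1 : ℝ) * c • (1 : ℝ)
      simpa using mul_self_pos.2 hc
    · have := hpos _ _ hv'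
      have := mul_self_nonneg (θ x v)
      linarith
  let g : ContMDiffRiemannianMetric 𝓘(ℝ, E) ∞ E (fun x : M ↦ TangentSpace 𝓘(ℝ, E) x) :=
    { inner := G
      symm := fun x v w ↦ by rw [hG, hG, hsymm, mul_comm]
      pos := hGpos
      isVonNBounded := fun x ↦ isVonNBounded_of_pos (E := E) (G x) (hGpos x)
      contMDiff := fun x ↦ hGsm x }
  have hGU (x : M) (v : TangentSpace 𝓘(ℝ, E) x) : θ x v = G x v (U x) := by
    rw [hG, hp.mfderiv_apply_field, map_zero, hθU, zero_add, mul_one]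
  refine ⟨g, isParallel_of_closed_of_killing g hU hθ hGU hclosed fun x v w ↦ ?_,
    fun x ↦ (hGU x (U x)).symm.trans (hθU x), hGU⟩
  have hUd := differentiableAt_chartField ((hU x).mdifferentiableAt (by simp))
  have hθd := (isSmoothFormAt_iff.1 (hθ x)).differentiableAt (by simp)
  have hhd := (isSmoothBilinAt_iff.1 (hsm (p x))).differentiableAt (by simp)
  rw [← chartMap_center (E := E) (E' := F) p x] at hhd
  -- `U` is Killing: `dp(U) = 0` handles `p^*h`, while `θ(U) = 1` and `dθ = 0` give `L_U θ = 0`.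
  have key := killing_of_pullback_add (P := chartMap E F p x) (u := chartField U x)
    (q := extChartAt 𝓘(ℝ, E) x x) (h := chartBilin h (p x)) (α := chartForm θ x)
    (G := chartBilin G x) (contDiffAt_chartMap (hp.contMDiff x)) hUd hhd hθd
    ((isSmoothBilinAt_iff.1 (hGsm x)).differentiableAt (by simp))
    (fderiv_chartMap_chartField (hp.contMDiff x) hp.mfderiv_apply_field)
    (fderiv_form_add_eq_zero (c := 1) hθd hUd (by
      filter_upwards [eventually_mem_chart_target x] with y hy
      rw [chartForm_apply, chartFrame_chartField U hy]
      exact hθU _) (by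
      rw [chartField_center]
      exact fderiv_chartForm_swap_of_curryLeft hθd (by rw [hclosed]; rfl)))
    (by
      filter_upwards [chartBilin_pullbackBilin (hp.contMDiff x) h] with y hy v w
      rw [chartBilin_addSq]
      exact congrArg₂ (· + ·) congr($hy v w) rfl) v w
  rw [chartField_center, chartBilin_center] at key
  exact key

end Parallel

end LCS

end

theorem proposition5p1 (n : ℕ)
    {M : Type*} [TopologicalSpace M] [ChartedSpace (EuclideanSpace ℝ (Fin (2 * n + 2))) M]
    [IsManifold (𝓡 (2 * n + 2)) ∞ M] [T2Space M] [CompactSpace M] [ConnectedSpace M]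
    (θ η : Π x : M, TangentSpace (𝓡 (2 * n + 2)) x →L[ℝ] ℝ)
    (hM : LCS.IsLCSFirstKind n θ η)
    (U V : Π x : M, TangentSpace (𝓡 (2 * n + 2)) x)
    (hU : LCS.IsLeeField θ η U) (hV : LCS.IsAntiLeeField θ η V)
    {N : Type*} [TopologicalSpace N] [ChartedSpace (EuclideanSpace ℝ (Fin (2 * n + 1))) N]
    [IsManifold (𝓡 (2 * n + 1)) ∞ N] [T2Space N]
    (p : M → N)
    (hp : LCS.IsOrbitManifold (E' := EuclideanSpace ℝ (Fin (2 * n + 1))) U p) :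
    (∃ ηN : Π y : N, TangentSpace (𝓡 (2 * n + 1)) y →L[ℝ] ℝ,
      LCS.IsContactForm n ηN ∧ LCS.pullback p ηN = η ∧
      ∃ ξ : Π y : N, TangentSpace (𝓡 (2 * n + 1)) y,
        LCS.ProjectsTo p V ξ ∧ LCS.IsReebField ηN ξ) ∧
    (∃ g : Bundle.ContMDiffRiemannianMetric (𝓡 (2 * n + 2)) ∞
        (EuclideanSpace ℝ (Fin (2 * n + 2))) (fun x : M ↦ TangentSpace (𝓡 (2 * n + 2)) x),
      LCS.IsParallel g U ∧ (∀ x, g.inner x (U x) (U x) = 1) ∧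
      ∀ (x : M) (v : TangentSpace (𝓡 (2 * n + 2)) x), θ x v = g.inner x v (U x)) := by
  have hU0 (x : M) : U x ≠ 0 := fun h0 ↦ by
    have := hU.lee x
    rw [h0, map_zero] at this
    exact zero_ne_one this
  have hdim : Module.finrank ℝ (EuclideanSpace ℝ (Fin (2 * n + 2))) =
      Module.finrank ℝ (EuclideanSpace ℝ (Fin (2 * n + 1))) + 1 := by simp
  -- Compactness passes to `N` and makes it σ-compact, as the partition of unity behind the metric
  -- on `N` requires.
  have : CompactSpace N := ⟨by
    rw [← hp.surjective.range_eq]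
    exact isCompact_range hp.contMDiff.continuous⟩
  refine ⟨?_, hp.exists_metric hU.smooth hdim hM.smooth_lee hU.lee hM.closed⟩
  obtain ⟨ηN, hηN, hpull⟩ :=
    hp.exists_form hU.smooth hU0 hdim hM.smooth_antiLee hU.antiLee hU.interior
  exact ⟨ηN, LCS.isContactForm_of_pullback hp.contMDiff hp.surjective hM (by simp) hηN hpull,
    hpull, hp.exists_reeb hM hU0 hV hηN hpull⟩
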